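/- Let $F$ be a real vector space of dimension $l+2$ with a symmetric bilinear form $I$ of signature $(l,2,0)$, i.e. $I$ is positive semi-definite and its radical $\mathrm{rad}(I)$ has dimension $2$. For $I(\alpha,\alpha)\neq 0$ put $\alpha^\vee=\frac{2}{I(\alpha,\alpha)}\alpha$ and $w_\alpha(x)=x-I(x,\alpha^\vee)\alpha$. An *elliptic root system* in $(F,I)$ is a non-empty discrete subset $R\subset F$ such that: the group $Q(R)=\mathbb{Z}R$ is a full lattice in $F$; $I(\alpha,\alpha)\ne 0$ and $w_\alpha(R)=R$ for all $\alpha\in R$; $I(\alpha^\vee,\beta)\in\mathbb{Z}$ for all $\alpha,\beta\in R$; and $R$ is not the union of two non-empty mutually orthogonal subsets. A *marking* of $R$ is a one-dimensional subspace $G\subset \mathrm{rad}(I)$ such that $G\cap Q(R)$ spans $G$; then $(R,G)$ is a *marked elliptic root system*, and $R/G$ denotes the image of $R$ in $F/G$. A set of roots is *reduced* if it contains neither $2\alpha$ nor $\frac12\alpha$ for any of its elements $\alpha$. An *isomorphism* of elliptic root systems $R\subset (F,I)$, $R'\subset(F',I')$ is a linear isomorphism $\varphi:F\to F'$ with $\varphi(R)=R'$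 that carries $I$ to $I'$ up to a positive scalar; for marked ones, also $\varphi(G)=G'$. Let $\mathbb{R}^{l+2}$ have basis $\varepsilon_1,\dots,\varepsilon_l,a,b$ and the form with $I(\varepsilon_i,\varepsilon_j)=\delta_{ij}$ and radical $\mathbb{R}a\oplus\mathbb{R}b$. Put $B_s=\{\pm\varepsilon_i\}$, $B_m=\{\pm(\varepsilon_i\pm\varepsilon_j): i<j\}$, $B_l=\{\pm2\varepsilon_i\}$, $L_{1,1}=\{ma+nb: m,n\in\mathbb{Z},\ (m-1)(n-1)\equiv 0 \bmod 2\}$, and define the following subsets of $\mathbb{R}^{l+2}$, each marked by $\mathbb{R}a$: \begin{align*} BC_l^{(1,2)}&=(B_s+\mathbb{Z}a+\mathbb{Z}b)\cup(B_m+\mathbb{Z}a+\mathbb{Z}b)\cup(B_l+(1+2\mathbb{Z})a+\mathbb{Z}b),\\ BC_l^{(4,2)}&=(B_s+\mathbb{Z}a+\mathbb{Z}b)\cup(B_m+\mathbb{Z}a+2\mathbb{Z}b)\cup(B_l+(1+2\mathbb{Z})a+4\mathbb{Z}b),\\ BC_l^{(2,2)\sigma}(1)&=(B_s+\mathbb{Z}a+\mathbb{Z}b)\cup(B_m+\mathbb{Z}a+\mathbb{Z}b)\cup(B_l+(1+2\mathbb{Z})a+2\mathbb{Z}b),\\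 BC_l^{(2,2)\sigma}(2)&=(B_s+\mathbb{Z}a+\mathbb{Z}b)\cup(B_m+\mathbb{Z}a+2\mathbb{Z}b)\cup(B_l+(1+2\mathbb{Z})a+2\mathbb{Z}b),\\ BC_l^{(1,1)\ast}&=(B_s+\mathbb{Z}a+\mathbb{Z}b)\cup(B_m+\mathbb{Z}a+\mathbb{Z}b)\cup(B_l+L_{1,1}),\\ BC_l^{(4,4)\ast}&=(B_s+L_{1,1})\cup(B_m+2\mathbb{Z}a+2\mathbb{Z}b)\cup(B_l+4\mathbb{Z}a+4\mathbb{Z}b). \end{align*} **Theorem.** Let $R$ be a reduced elliptic root system in a space with form of signature $(l,2,0)$. (1) If $G$ is a marking of $R$ such that $R/G$ is non-reduced, then $(R,G)$ is isomorphic, as a marked elliptic root system, to one of $BC_l^{(1,2)}$, $BC_l^{(1,1)\ast}$, $BC_l^{(4,2)}$, $BC_l^{(4,4)\ast}$, $BC_l^{(2,2)\sigma}(2)$ ($l\ge1$), or $BC_l^{(2,2)\sigma}(1)$ ($l\geq2$). (2) Either $R$ has a marking $G$ with $R/G$ reduced (so that $R$ occurs in K. Saito's 1985 classification of the marked elliptic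 root systems with reduced quotient), or $R$ is isomorphic to $BC_l^{(1,1)\ast}$ or $BC_l^{(4,4)\ast}$. -/

import Mathlib

open scoped Pointwise

noncomputable section

namespace EllipticRoot

section General

variable {F : Type*} [NormedAddCommGroup F] [NormedSpace ℝ F]

/-- The root lattice `Q(R)`: the additive group spanned by `R`. -/
def rootLattice (R : Set F) : Submodule ℤ F := Submodule.span ℤ R

/-- The coroot `α^∨ = (2 / I(α, α)) α` of a non-isotropic vector `α`. -/
def coroot (I : LinearMap.BilinForm ℝ F) (α : F) : F := (2 / I α α) • α

/-- The reflection `w_α(x) = x - I(x, α^∨) α`. -/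
def reflect (I : LinearMap.BilinForm ℝ F) (α x : F) : F := x - I x (coroot I α) • α

/-- The radical of `I` (for symmetric `I`, the left and right kernels agree). -/
def rad (I : LinearMap.BilinForm ℝ F) : Submodule ℝ F := LinearMap.ker I

/-- Generalized root systems belonging to `(F, I)`. -/
structure IsGeneralizedRootSystem (I : LinearMap.BilinForm ℝ F) (R : Set F) : Prop where
  nonempty : R.Nonempty
  discrete : DiscreteTopology R
  /-- `Q(R)` is a lattice ... -/
  lattice : DiscreteTopology (rootLattice R)
  /-- ... which is full in `F`. -/
  full : Submodule.span ℝ (rootLattice R : Set F) = ⊤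
  nonisotropic : ∀ α ∈ R, I α α ≠ 0
  integral : ∀ α ∈ R, ∀ β ∈ R, ∃ n : ℤ, I (coroot I α) β = n
  reflect_image : ∀ α ∈ R, reflect I α '' R = R
  irreducible : ∀ R₁ R₂ : Set F, R₁ ∪ R₂ = R → (∀ x ∈ R₁, ∀ y ∈ R₂, I x y = 0) →
    R₁ = ∅ ∨ R₂ = ∅

/-- Elliptic root systems of rank `l`: generalized root systems for a symmetric form of signature
`(l, 2, 0)`, i.e. positive semi-definite with two-dimensional radical on a space of dimension
`l + 2`. -/
structure IsElliptic (I : LinearMap.BilinForm ℝ F) (l : ℕ) (R : Set F) : Prop where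
  posSemidef : I.IsPosSemidef
  finrank_space : Module.finrank ℝ F = l + 2
  finrank_rad : Module.finrank ℝ (rad I) = 2
  rootSystem : IsGeneralizedRootSystem I R

/-- A (one-dimensional) marking of `R`: a line `G` in the radical in which `G ∩ Q(R)` is full. -/
structure IsMarking (I : LinearMap.BilinForm ℝ F) (R : Set F) (G : Submodule ℝ F) : Prop where
  le_rad : G ≤ rad I
  finrank_eq : Module.finrank ℝ G = 1
  full : Submodule.span ℝ ((G : Set F) ∩ (rootLattice R : Set F)) = G

/-- `R` is reduced if for any `α ∈ R`, neither `2α` nor `α/2` belongs to `R`. -/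
def IsReduced {V : Type*} [AddCommGroup V] [Module ℝ V] (R : Set V) : Prop :=
  ∀ α ∈ R, (2 : ℝ) • α ∉ R ∧ (1 / 2 : ℝ) • α ∉ R

/-- The quotient root system `R/G`: the image of `R` in `F/G`. -/
def quotientSystem (R : Set F) (G : Submodule ℝ F) : Set (F ⧸ G) := G.mkQ '' R

variable {F' : Type*} [NormedAddCommGroup F'] [NormedSpace ℝ F']

/-- `φ` is an isomorphism of root systems: a linear isomorphism with `φ(R) = R'` which carries one
form to a positive multiple of the other. -/
def IsRootSystemIso (I : LinearMap.BilinForm ℝ F) (R : Set F)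
    (I' : LinearMap.BilinForm ℝ F') (R' : Set F') (φ : F ≃ₗ[ℝ] F') : Prop :=
  φ '' R = R' ∧ ∃ c : ℝ, 0 < c ∧ ∀ x y, I' (φ x) (φ y) = c * I x y

end General

section Models

/-- The space `ℝ^{l+2}`, with coordinates along `ε_1, …, ε_l` and along `a`, `b`. -/
abbrev Space (l : ℕ) : Type := (Fin l → ℝ) × (ℝ × ℝ)

/-- The form of signature `(l, 2, 0)` on `ℝ^{l+2}`: `I(ε_i, ε_j) = δ_{ij}`, radical `ℝa ⊕ ℝb`. -/
def form (l : ℕ) : LinearMap.BilinForm ℝ (Space l) :=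
  (dotProductBilin ℝ ℝ).compl₁₂ (LinearMap.fst ℝ (Fin l → ℝ) (ℝ × ℝ))
    (LinearMap.fst ℝ (Fin l → ℝ) (ℝ × ℝ))

theorem form_apply (l : ℕ) (x y : Space l) : form l x y = ∑ i, x.1 i * y.1 i := rfl

variable (l : ℕ)

def ε (i : Fin l) : Space l := (Pi.single i 1, 0)

def a : Space l := (0, (1, 0))

def b : Space l := (0, (0, 1))

/-- The marking `G = ℝa`. -/
def markingA : Submodule ℝ (Space l) := Submodule.span ℝ {a l}

/-- `R(BC_l)_s = {± ε_i}`. -/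
def bcShort : Set (Space l) := {x | ∃ i, x = ε l i ∨ x = -ε l i}

/-- `R(BC_l)_m = {± (ε_i ± ε_j) | i < j}`. -/
def bcMiddle : Set (Space l) :=
  {x | ∃ i j, i < j ∧ (x = ε l i + ε l j ∨ x = -(ε l i + ε l j) ∨
    x = ε l i - ε l j ∨ x = -(ε l i - ε l j))}

/-- `R(BC_l)_l = {± 2ε_i}`. -/
def bcLong : Set (Space l) := {x | ∃ i, x = (2 : ℝ) • ε l i ∨ x = -((2 : ℝ) • ε l i)}

variable {l} in
/-- The set `kℤv`. -/
def zmul (k : ℤ) (v : Space l) : Set (Space l) := {x | ∃ n : ℤ, x = (k * n) • v}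

/-- The set `(1 + 2ℤ)a`. -/
def oddA : Set (Space l) := {x | ∃ n : ℤ, x = (1 + 2 * n) • a l}

/-- The set `L_{1,1} = {ma + nb | (m - 1)(n - 1) ≡ 0 mod 2}`. -/
def L11 : Set (Space l) :=
  {x | ∃ m n : ℤ, (m - 1) * (n - 1) ≡ 0 [ZMOD 2] ∧ x = m • a l + n • b l}

/-- The four families of non-reduced affine root systems `BCC_l`, `C^∨BC_l`, `BB_l^∨`, `C^∨C_l`. -/
inductive AffineType
  | BCC
  | CveeBC
  | BBvee
  | CveeC

/-- The middle roots of `R(X_l)` are `R(BC_l)_m + kℤb` with this `k`. -/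
def AffineType.middleStep : AffineType → ℤ
  | .BCC => 1
  | .CveeBC => 2
  | .BBvee => 1
  | .CveeC => 2

/-- The long roots of `R(X_l)` are `R(BC_l)_l + kℤb` with this `k`. -/
def AffineType.longStep : AffineType → ℤ
  | .BCC => 1
  | .CveeBC => 4
  | .BBvee => 2
  | .CveeC => 2

/-- `R(X_l)_s`. -/
def affShort (_X : AffineType) : Set (Space l) := bcShort l + zmul 1 (b l)

/-- `R(X_l)_m`. -/
def affMiddle (X : AffineType) : Set (Space l) := bcMiddle l + zmul X.middleStep (b l)

/-- `R(X_l)_l`. -/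
def affLong (X : AffineType) : Set (Space l) := bcLong l + zmul X.longStep (b l)

/-- `(R(X_l)_s + ℤa) ∪ (R(X_l)_m + ℤa) ∪ (R(X_l)_l + (1 + 2ℤ)a)`. -/
def reducedClassical (X : AffineType) : Set (Space l) :=
  (affShort l X + zmul 1 (a l)) ∪ (affMiddle l X + zmul 1 (a l)) ∪ (affLong l X + oddA l)

/-- `BC_l^{(1,2)}`. -/
def BC12 : Set (Space l) := reducedClassical l .BCC

/-- `BC_l^{(4,2)}`. -/
def BC42 : Set (Space l) := reducedClassical l .CveeBC

/-- `BC_l^{(2,2)σ}(1)`. -/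
def BC22σ1 : Set (Space l) := reducedClassical l .BBvee

/-- `BC_l^{(2,2)σ}(2)`. -/
def BC22σ2 : Set (Space l) := reducedClassical l .CveeC

/-- `BC_l^{(1,1)*}`. -/
def BC11star : Set (Space l) :=
  (affShort l .BCC + zmul 1 (a l)) ∪ (affMiddle l .BCC + zmul 1 (a l)) ∪ (bcLong l + L11 l)

/-- `BC_l^{(4,4)*}`. -/
def BC44star : Set (Space l) :=
  (bcShort l + L11 l) ∪ (affMiddle l .CveeBC + zmul 2 (a l)) ∪
    (affLong l .CveeBC + zmul 4 (a l))

end Models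

section Isomorphism

variable {F : Type*} [NormedAddCommGroup F] [NormedSpace ℝ F]

/-- `R` is isomorphic, as a root system, to the subset `T` of the standard space `ℝ^{l+2}`. -/
def IsoTo (I : LinearMap.BilinForm ℝ F) (R : Set F) (l : ℕ) (T : Set (Space l)) : Prop :=
  ∃ φ : F ≃ₗ[ℝ] Space l, IsRootSystemIso I R (form l) T φ

/-- `(R, G)` is isomorphic, as a marked root system, to `(T, ℝa)`. -/
def MarkedIsoTo (I : LinearMap.BilinForm ℝ F) (R : Set F) (G : Submodule ℝ F) (l : ℕ)
    (T : Set (Space l)) : Prop :=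
  ∃ φ : F ≃ₗ[ℝ] Space l, IsRootSystemIso I R (form l) T φ ∧
    G.map (φ : F →ₗ[ℝ] Space l) = markingA l

end Isomorphism

end EllipticRoot

end

/-!
If `R` contains a root together with, modulo the radical, the double of that root, then a maximal
orthonormal family of such doubled roots is a frame in which the roots are `±ε_i`, `±ε_i ± ε_j`,
`±2ε_i`, translated by sets `S`, `M`, `L` of radical vectors. The reflections force closure
properties such as `M + 2S ⊆ M` and `L + 4S ⊆ L`, so that `S`, `M`, `L` are determined by residues
modulo `2`, `2` and `4` in the lattice `⟨S⟩ ≅ ℤ²`, whose basis can be chosen with first vector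
spanning `G`. Reducedness says that `L` is disjoint from `2S`, non-reducedness modulo `G` that some
element of `L` has even second coordinate. If `S` misses a residue class, it misses exactly one, and
`M`, `L` are forced; otherwise `M` is everything or consists of the pairs with even second
coordinate, and few sets `L` remain, up to the choice of the origin of the frame and of the second
basis vector.

For the second part, the radical contains a non-zero element of the root lattice, so that `R` has a
marking. If its quotient is not reduced, the first part applies; apart from the two starred systems,
it puts `R` in a form where the long roots have odd `a`-coordinate, whereas the double of a root has
an even one, so that the marking `ℝb` has a reduced quotient.
-/

noncomputable section

namespace EllipticRoot

open scoped Matrix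

section Module

variable {V : Type*} [AddCommGroup V] [Module ℝ V]

/-- The scale-invariant part of the axioms of a generalized root system for a positive
semi-definite form. Reflections are written without division: `t` plays the role of
`J(α^∨, β)`. -/
structure IsSemidefRootSystem (J : LinearMap.BilinForm ℝ V) (R : Set V) : Prop where
  symm : ∀ x y, J x y = J y x
  nonneg : ∀ x, 0 ≤ J x x
  pos : ∀ α ∈ R, 0 < J α α
  integral : ∀ α ∈ R, ∀ β ∈ R, ∃ n : ℤ, 2 * J α β = n * J α α
  reflect_mem : ∀ α ∈ R, ∀ β ∈ R, ∀ t : ℝ, 2 * J α β = t * J α α → β - t • α ∈ R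
  irreducible : ∀ R₁ R₂ : Set V, R₁ ∪ R₂ = R → (∀ x ∈ R₁, ∀ y ∈ R₂, J x y = 0) →
    R₁ = ∅ ∨ R₂ = ∅

/-- A root of length one whose double is, modulo the kernel of the form, also a root. -/
structure IsDoubled (J : LinearMap.BilinForm ℝ V) (R : Set V) (e : V) : Prop where
  mem : e ∈ R
  unit : J e e = 1
  double : ∃ f ∈ R, f - (2 : ℝ) • e ∈ LinearMap.ker J

theorem apply_eq_zero_of_mem_ker {J : LinearMap.BilinForm ℝ V} {x : V}
    (hx : x ∈ LinearMap.ker J) (y : V) : J x y = 0 := by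
  rw [LinearMap.mem_ker.1 hx, LinearMap.zero_apply]

theorem apply_eq_of_sub_mem_ker {J : LinearMap.BilinForm ℝ V} {x y : V}
    (h : x - y ∈ LinearMap.ker J) (z : V) : J x z = J y z := by
  simpa [sub_eq_zero] using apply_eq_zero_of_mem_ker h z

/-- Here `n = I(e, β)` and `q = I(β, β)` for a doubled root `e`: the hypothesis `n ^ 2 ≤ q` is the
Cauchy-Schwarz inequality, an equality when `β` is a multiple of `e` modulo the radical. -/
theorem eq_two_or_eq_sq_of_two_mul_eq {n k : ℤ} {q : ℝ} (hn : n ≠ 0) (hk : 2 * n = k * q)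
    (hq : (n : ℝ) ^ 2 ≤ q) :
    (q = 2 ∧ (n = 1 ∨ n = -1)) ∨ (q = n ^ 2 ∧ (n = 1 ∨ n = -1 ∨ n = 2 ∨ n = -2)) := by
  have hn0 : (n : ℝ) ≠ 0 := mod_cast hn
  have hk0 : k ≠ 0 := by rintro rfl; simp [hn0] at hk
  have habs : |n * k| ≤ 2 := by
    have hle : ((n * k) ^ 2 : ℝ) ≤ 2 * (n * k) :=
      calc ((n * k) ^ 2 : ℝ) = k ^ 2 * n ^ 2 := by ring
        _ ≤ k ^ 2 * q := by gcongr
        _ = 2 * (n * k) := by linear_combination -k * hk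
    have hle : (n * k) ^ 2 ≤ 2 * (n * k) := mod_cast hle
    rw [abs_le]
    constructor <;> nlinarith
  have hn2 : |n| ≤ 2 := (le_mul_of_one_le_right (abs_nonneg n) (Int.one_le_abs hk0)).trans
    (abs_mul n k ▸ habs)
  have hk2 : |k| ≤ 2 := (le_mul_of_one_le_left (abs_nonneg k) (Int.one_le_abs hn)).trans
    (abs_mul n k ▸ habs)
  rw [abs_le] at hn2 hk2
  obtain ⟨hn1, hn2⟩ := hn2
  obtain ⟨hk1, hk2⟩ := hk2
  interval_cases n <;> interval_cases k <;> norm_num at * <;> grind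

namespace IsSemidefRootSystem

variable {J : LinearMap.BilinForm ℝ V} {R : Set V}

theorem smul (h : IsSemidefRootSystem J R) {c : ℝ} (hc : 0 < c) :
    IsSemidefRootSystem (c • J) R where
  symm x y := by simp [h.symm x y]
  nonneg x := by simpa using mul_nonneg hc.le (h.nonneg x)
  pos α hα := by simpa using mul_pos hc (h.pos α hα)
  integral α hα β hβ := by
    obtain ⟨n, hn⟩ := h.integral α hα β hβ
    refine ⟨n, ?_⟩
    simp only [LinearMap.smul_apply, smul_eq_mul]
    linear_combination c * hn
  reflect_mem α hα β hβ t ht := by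
    refine h.reflect_mem α hα β hβ t ?_
    simp only [LinearMap.smul_apply, smul_eq_mul] at ht
    exact mul_left_cancel₀ hc.ne' (by linear_combination ht)
  irreducible R₁ R₂ hR ho :=
    h.irreducible R₁ R₂ hR fun x hx y hy => by simpa [hc.ne'] using ho x hx y hy

theorem neg_mem (h : IsSemidefRootSystem J R) {α : V} (hα : α ∈ R) : -α ∈ R := by
  have hmem := h.reflect_mem α hα α hα 2 rfl
  rwa [two_smul, sub_add_cancel_left] at hmem

theorem apply_sq_le (h : IsSemidefRootSystem J R) (x y : V) : J x y ^ 2 ≤ J x x * J y y :=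
  LinearMap.BilinForm.apply_sq_le_of_symm J h.nonneg ⟨h.symm⟩ x y

theorem mem_ker_of_apply_self_eq_zero (h : IsSemidefRootSystem J R) {x : V} (hx : J x x = 0) :
    x ∈ LinearMap.ker J := by
  refine LinearMap.mem_ker.2 (LinearMap.ext fun y => ?_)
  have hle := h.apply_sq_le x y
  rw [hx, zero_mul] at hle
  exact pow_eq_zero_iff two_ne_zero |>.1 (le_antisymm hle (sq_nonneg _))

theorem apply_eq_zero_of_mem_ker_right (h : IsSemidefRootSystem J R) {y : V}
    (hy : y ∈ LinearMap.ker J) (x : V) : J x y = 0 := by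
  rw [h.symm, apply_eq_zero_of_mem_ker hy]

theorem forall_of_orthogonal (h : IsSemidefRootSystem J R) {P : V → Prop} {α : V} (hα : α ∈ R)
    (hPα : P α) (hP : ∀ x ∈ R, P x → ∀ y ∈ R, ¬P y → J x y = 0) : ∀ β ∈ R, P β := by
  rcases h.irreducible {x ∈ R | P x} {x ∈ R | ¬P x} (Set.sep_or.symm.trans (by simp [em]))
    fun x hx y hy => hP x hx.1 hx.2 y hy.1 hy.2 with hempty | hempty
  · exact absurd hempty (Set.Nonempty.ne_empty ⟨α, hα, hPα⟩)
  · exact fun β hβ => by_contra fun hPβ => (hempty ▸ Set.notMem_empty β) ⟨hβ, hPβ⟩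

theorem apply_doubled (h : IsSemidefRootSystem J R) {e β : V} (he : IsDoubled J R e)
    (hβ : β ∈ R) :
    J e β = 0 ∨
      (∃ σ : ℝ, (σ = 1 ∨ σ = -1) ∧
        (β - σ • e ∈ LinearMap.ker J ∨ β - (2 * σ) • e ∈ LinearMap.ker J)) ∨
      (J β β = 2 ∧ (J e β = 1 ∨ J e β = -1)) := by
  obtain ⟨f, hfR, hfe⟩ := he.double
  have hf (x : V) : J f x = 2 * J e x := by simpa using apply_eq_of_sub_mem_ker hfe x
  obtain ⟨n, hn⟩ : ∃ n : ℤ, J e β = n := by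
    obtain ⟨n, hn⟩ := h.integral f hfR β hβ
    refine ⟨n, ?_⟩
    rw [hf β, hf f, h.symm e f, hf e, he.unit] at hn
    linarith
  obtain ⟨k, hk⟩ := h.integral β hβ e he.mem
  rw [h.symm, hn] at hk
  have hle : (n : ℝ) ^ 2 ≤ J β β := by simpa [hn, he.unit] using h.apply_sq_le e β
  rcases eq_or_ne n 0 with rfl | hn0
  · exact Or.inl (by simpa using hn)
  rcases eq_two_or_eq_sq_of_two_mul_eq hn0 hk hle with ⟨hββ, hn1⟩ | ⟨hββ, hn2⟩
  · exact Or.inr (Or.inr ⟨hββ, by rcases hn1 with rfl | rfl <;> simp [hn]⟩)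
  have hker : β - (n : ℝ) • e ∈ LinearMap.ker J := by
    refine h.mem_ker_of_apply_self_eq_zero ?_
    simp only [map_sub, map_smul, LinearMap.sub_apply, LinearMap.smul_apply, smul_eq_mul,
      h.symm β e, hn, hββ, he.unit]
    ring
  refine Or.inr (Or.inl ?_)
  rcases hn2 with rfl | rfl | rfl | rfl
  · exact ⟨1, by simp, Or.inl (by simpa using hker)⟩
  · exact ⟨-1, by simp, Or.inl (by simpa using hker)⟩
  · exact ⟨1, by simp, Or.inr (by simpa using hker)⟩
  · exact ⟨-1, by simp, Or.inr (by simpa using hker)⟩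

end IsSemidefRootSystem

theorem IsDoubled.sub_smul {J : LinearMap.BilinForm ℝ V} {R : Set V} {e β : V}
    (he : IsDoubled J R e) (h : IsSemidefRootSystem J R) (hβ : β ∈ R) {t : ℝ}
    (ht : 2 * J β e = t * J β β) : IsDoubled J R (e - t • β) := by
  obtain ⟨f, hfR, hfe⟩ := he.double
  have hf : J β f = 2 * J β e := by
    rw [h.symm, apply_eq_of_sub_mem_ker hfe, map_smul, LinearMap.smul_apply, smul_eq_mul, h.symm]
  refine ⟨h.reflect_mem β hβ e he.mem t ht, ?_,
    f - (2 * t) • β, h.reflect_mem β hβ f hfR _ (by rw [hf, ht, mul_assoc]), ?_⟩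
  · simp only [map_sub, map_smul, LinearMap.sub_apply, LinearMap.smul_apply, smul_eq_mul,
      h.symm e β, he.unit]
    linear_combination -t * ht
  · convert hfe using 1
    module

end Module

section Coordinates

variable {ι : Type*} [DecidableEq ι]

/-- The coordinate vectors `±ε_i` of the short roots. -/
def IsShortVec (v : ι → ℝ) : Prop :=
  ∃ i, ∃ σ : ℝ, (σ = 1 ∨ σ = -1) ∧ v = Pi.single i σ

/-- The coordinate vectors `±ε_i ± ε_j` of the middle roots. -/
def IsMiddleVec (v : ι → ℝ) : Prop :=
  ∃ i j, i ≠ j ∧ ∃ σ τ : ℝ, (σ = 1 ∨ σ = -1) ∧ (τ = 1 ∨ τ = -1) ∧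
    v = Pi.single i σ + Pi.single j τ

/-- The coordinate vectors `±2ε_i` of the long roots. -/
def IsLongVec (v : ι → ℝ) : Prop :=
  ∃ i, ∃ σ : ℝ, (σ = 1 ∨ σ = -1) ∧ v = Pi.single i (2 * σ)

/-- The coordinate vectors of the finite root system of type `BC`. -/
def IsBCVec (v : ι → ℝ) : Prop :=
  IsShortVec v ∨ IsMiddleVec v ∨ IsLongVec v

theorem IsBCVec.eq_single_add_single {v : ι → ℝ} (hv : IsBCVec v) {i j : ι} (hij : i ≠ j)
    (hi : v i ≠ 0) (hj : v j ≠ 0) :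
    ∃ σ τ : ℝ, (σ = 1 ∨ σ = -1) ∧ (τ = 1 ∨ τ = -1) ∧ v = Pi.single i σ + Pi.single j τ := by
  have support_single {p q : ι} {c : ℝ} (h : (Pi.single p c : ι → ℝ) q ≠ 0) : q = p :=
    by_contra fun hqp => h (Pi.single_eq_of_ne (M := fun _ => ℝ) hqp c)
  rcases hv with ⟨p, σ, -, rfl⟩ | ⟨p, q, -, σ, τ, hσ, hτ, rfl⟩ | ⟨p, σ, -, rfl⟩
  · exact absurd ((support_single hi).trans (support_single hj).symm) hij
  · have support {r : ι} (h : (Pi.single p σ + Pi.single q τ : ι → ℝ) r ≠ 0) : r = p ∨ r = q := by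
      by_contra! hr
      exact h (by simp [hr])
    rcases support hi with rfl | rfl <;> rcases support hj with rfl | rfl
    · exact absurd rfl hij
    · exact ⟨σ, τ, hσ, hτ, rfl⟩
    · exact ⟨τ, σ, hτ, hσ, add_comm _ _⟩
    · exact absurd rfl hij
  · exact absurd ((support_single hi).trans (support_single hj).symm) hij

end Coordinates

section Orthonormal

variable {V : Type*} [AddCommGroup V] [Module ℝ V] {ι : Type*} [DecidableEq ι]

/-- A family of roots which is orthonormal for the form. -/
structure IsOrthonormalRootFamily (J : LinearMap.BilinForm ℝ V) (R : Set V) (e : ι → V) : Prop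
    extends IsSemidefRootSystem J R where
  orthonormal : ∀ i j, J (e i) (e j) = if i = j then 1 else 0
  short_mem : ∀ i, e i ∈ R

theorem IsOrthonormalRootFamily.linearIndependent {J : LinearMap.BilinForm ℝ V} {R : Set V}
    {e : ι → V} (h : IsOrthonormalRootFamily J R e) : LinearIndependent ℝ e := by
  refine linearIndependent_iff'.2 fun s g hg i hi => ?_
  simpa [h.orthonormal, hi] using congrArg (J (e i)) hg

end Orthonormal

section Fibres

variable {V : Type*} [AddCommGroup V] [Module ℝ V] {ι : Type*} [Fintype ι]

/-- The vector with coordinates `v` in the family `e`. -/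
abbrev comb (e : ι → V) : (ι → ℝ) →ₗ[ℝ] V := Fintype.linearCombination ℝ e

/-- The fibre of `R` over the vector with coordinates `v` in the family `e`, as a set of
translations in the kernel of the form. -/
def fibre (J : LinearMap.BilinForm ℝ V) (R : Set V) (e : ι → V) (v : ι → ℝ) : Set V :=
  {r | r ∈ LinearMap.ker J ∧ comb e v + r ∈ R}

variable [DecidableEq ι]

theorem comb_single (e : ι → V) (i : ι) (c : ℝ) : comb e (Pi.single i c) = c • e i :=
  Fintype.linearCombination_apply_single ℝ e i c

namespace IsOrthonormalRootFamily

variable {J : LinearMap.BilinForm ℝ V} {R : Set V} {e : ι → V}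

theorem apply_comb (h : IsOrthonormalRootFamily J R e) (i : ι) (v : ι → ℝ) :
    J (e i) (comb e v) = v i := by
  simp [Fintype.linearCombination_apply, h.orthonormal i]

theorem apply_eq_of_sub_comb_mem (h : IsOrthonormalRootFamily J R e) {x : V} {v : ι → ℝ}
    (hx : x - comb e v ∈ LinearMap.ker J) (i : ι) : J (e i) x = v i := by
  rw [h.symm, apply_eq_of_sub_mem_ker hx, h.symm, h.apply_comb]

theorem comb_apply_comb (h : IsOrthonormalRootFamily J R e) (u v : ι → ℝ) :
    J (comb e u) (comb e v) = u ⬝ᵥ v := by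
  rw [comb, Fintype.linearCombination_apply, dotProduct, map_sum, LinearMap.sum_apply]
  simp [h.apply_comb]

theorem add_smul_mem_fibre (h : IsOrthonormalRootFamily J R e) {u v : ι → ℝ} {r s : V}
    (hr : r ∈ fibre J R e v) (hs : s ∈ fibre J R e u) {t : ℝ}
    (ht : 2 * (u ⬝ᵥ v) = -t * (u ⬝ᵥ u)) : r + t • s ∈ fibre J R e (v + t • u) := by
  refine ⟨add_mem hr.1 (Submodule.smul_mem _ t hs.1), ?_⟩
  have hmem := h.reflect_mem _ hs.2 _ hr.2 (-t) ?_
  · convert hmem using 1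
    rw [map_add, map_smul]
    module
  · simp only [map_add, LinearMap.add_apply, h.comb_apply_comb, apply_eq_zero_of_mem_ker hs.1,
      h.apply_eq_zero_of_mem_ker_right hs.1, h.apply_eq_zero_of_mem_ker_right hr.1]
    linarith

theorem neg_mem_fibre_neg (h : IsOrthonormalRootFamily J R e) {v : ι → ℝ} {r : V}
    (hr : r ∈ fibre J R e v) : -r ∈ fibre J R e (-v) :=
  ⟨neg_mem hr.1, by rw [map_neg, ← neg_add]; exact h.neg_mem hr.2⟩

theorem zero_mem_fibre_single (h : IsOrthonormalRootFamily J R e) (i : ι) :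
    (0 : V) ∈ fibre J R e (Pi.single i 1) :=
  ⟨zero_mem _, by simpa [comb_single] using h.short_mem i⟩

theorem mem_fibre_update_neg (h : IsOrthonormalRootFamily J R e) {v : ι → ℝ} {r : V}
    (hr : r ∈ fibre J R e v) (i : ι) : r ∈ fibre J R e (Function.update v i (-v i)) := by
  have hmem := h.add_smul_mem_fibre hr (h.zero_mem_fibre_single i) (t := -(2 * v i)) (by simp)
  rw [smul_zero, add_zero] at hmem
  convert hmem using 2
  rw [Function.update_eq_iff]
  refine ⟨by simp; ring, fun j hj => by simp [hj]⟩

theorem mem_fibre_single_add_single (h : IsOrthonormalRootFamily J R e) {i j : ι} (hij : i ≠ j)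
    {σ τ σ' τ' : ℝ} {r : V} (hr : r ∈ fibre J R e (Pi.single i σ + Pi.single j τ))
    (hσ : σ' = σ ∨ σ' = -σ) (hτ : τ' = τ ∨ τ' = -τ) :
    r ∈ fibre J R e (Pi.single i σ' + Pi.single j τ') := by
  have flip {i j : ι} (hij : i ≠ j) {σ τ σ' : ℝ} (hσ : σ' = σ ∨ σ' = -σ)
      (hr : r ∈ fibre J R e (Pi.single i σ + Pi.single j τ)) :
      r ∈ fibre J R e (Pi.single i σ' + Pi.single j τ) := by
    rcases hσ with rfl | rfl
    · exact hr
    · convert h.mem_fibre_update_neg hr i using 2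
      symm
      rw [Function.update_eq_iff]
      exact ⟨by simp [hij], fun p hp => by simp [hp]⟩
  rw [add_comm]
  exact flip hij.symm hτ (by rw [add_comm]; exact flip hij hσ hr)

end IsOrthonormalRootFamily

end Fibres

section Links

variable {V : Type*} [AddCommGroup V] [Module ℝ V] {ι : Type*} [Fintype ι] [DecidableEq ι]

/-- The indices `i` and `j` are linked if some root is congruent to `e i - e j` modulo the kernel
of the form. -/
def IsLinked (J : LinearMap.BilinForm ℝ V) (R : Set V) (e : ι → V) (i j : ι) : Prop :=
  i = j ∨ (fibre J R e (Pi.single i 1 - Pi.single j 1)).Nonempty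

namespace IsOrthonormalRootFamily

variable {J : LinearMap.BilinForm ℝ V} {R : Set V} {e : ι → V}

theorem isLinked_trans (h : IsOrthonormalRootFamily J R e) {i j k : ι}
    (hij : IsLinked J R e i j) (hjk : IsLinked J R e j k) : IsLinked J R e i k := by
  rcases hij with rfl | ⟨r, hr⟩
  · exact hjk
  rcases hjk with rfl | ⟨s, hs⟩
  · exact Or.inr ⟨r, hr⟩
  rcases eq_or_ne i k with rfl | hik
  · exact Or.inl rfl
  rcases eq_or_ne i j with rfl | hij
  · exact Or.inr ⟨s, hs⟩
  rcases eq_or_ne j k with rfl | hjk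
  · exact Or.inr ⟨r, hr⟩
  have hmem := h.add_smul_mem_fibre hr hs (t := 1) (by
    simp [hij, hjk, hjk.symm, hik.symm]; norm_num)
  exact Or.inr ⟨_, by simpa using hmem⟩

theorem isLinked_of_apply_ne_zero (h : IsOrthonormalRootFamily J R e) {β : V} (hβ : β ∈ R)
    {v : ι → ℝ} (hv : IsBCVec v) (hβv : β - comb e v ∈ LinearMap.ker J) {i j : ι}
    (hi : J (e i) β ≠ 0) (hj : J (e j) β ≠ 0) : IsLinked J R e i j := by
  rcases eq_or_ne i j with hij | hij
  · exact Or.inl hij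
  rw [h.apply_eq_of_sub_comb_mem hβv] at hi hj
  obtain ⟨σ, τ, hσ, hτ, rfl⟩ := hv.eq_single_add_single hij hi hj
  have hmem : β - comb e (Pi.single i σ + Pi.single j τ) ∈
      fibre J R e (Pi.single i σ + Pi.single j τ) := ⟨hβv, by rwa [add_sub_cancel]⟩
  have hmem := h.mem_fibre_single_add_single hij hmem (σ' := 1) (τ' := -1)
    (by rcases hσ with rfl | rfl <;> simp) (by rcases hτ with rfl | rfl <;> simp)
  rw [Pi.single_neg, ← sub_eq_add_neg] at hmem
  exact Or.inr ⟨_, hmem⟩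

/-- The roots supported on the link class of `i` are orthogonal to the remaining ones. -/
theorem isLinked (h : IsOrthonormalRootFamily J R e)
    (hcoords : ∀ β ∈ R, ∃ v, IsBCVec v ∧ β - comb e v ∈ LinearMap.ker J) (i j : ι) :
    IsLinked J R e i j := by
  have apply_ne_zero {p q : ι} (hpq : J (e p) (e q) ≠ 0) : p = q := by
    rw [h.orthonormal] at hpq
    exact by_contra fun hne => hpq (if_neg hne)
  refine h.forall_of_orthogonal (P := fun x => ∀ p, J (e p) x ≠ 0 → IsLinked J R e i p)
    (h.short_mem i) (fun p hp => Or.inl (apply_ne_zero hp).symm) ?_ (e j) (h.short_mem j) j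
    (by simp [h.orthonormal])
  intro x hx hxi y hy hyi
  push Not at hyi
  obtain ⟨q, hqy, hiq⟩ := hyi
  obtain ⟨v, -, hxv⟩ := hcoords x hx
  obtain ⟨w, hw, hyw⟩ := hcoords y hy
  rw [apply_eq_of_sub_mem_ker hxv, Fintype.linearCombination_apply, map_sum, LinearMap.sum_apply]
  refine Finset.sum_eq_zero fun p _ => ?_
  rw [map_smul, LinearMap.smul_apply, smul_eq_mul, mul_eq_zero,
    ← h.apply_eq_of_sub_comb_mem hxv, or_iff_not_imp_left]
  intro hpx
  by_contra hpy
  exact hiq (h.isLinked_trans (hxi p hpx) (h.isLinked_of_apply_ne_zero hy hw hyw hpy hqy))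

end IsOrthonormalRootFamily

end Links

section Frames

variable {V : Type*} [AddCommGroup V] [Module ℝ V] {ι : Type*} [DecidableEq ι]
  {J : LinearMap.BilinForm ℝ V} {R : Set V} {e : ι → V}

/-- An orthonormal family of doubled roots which cannot be enlarged. -/
structure IsMaximalDoubledFamily (J : LinearMap.BilinForm ℝ V) (R : Set V) (e : ι → V) : Prop
    extends IsOrthonormalRootFamily J R e where
  isDoubled : ∀ i, IsDoubled J R (e i)
  maximal : ∀ γ, IsDoubled J R γ → ∃ i, J (e i) γ ≠ 0

theorem exists_isMaximalDoubledFamily [FiniteDimensional ℝ V] (h : IsSemidefRootSystem J R)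
    {α : V} (hα : IsDoubled J R α) :
    ∃ (n : ℕ) (e : Fin (n + 1) → V), IsMaximalDoubledFamily J R e := by
  classical
  let P : ℕ → Prop := fun n => ∃ e : Fin (n + 1) → V,
    (∀ i j, J (e i) (e j) = if i = j then 1 else 0) ∧ ∀ i, IsDoubled J R (e i)
  have le_finrank {n : ℕ} (hn : P n) : n ≤ Module.finrank ℝ V := by
    obtain ⟨e, he, hd⟩ := hn
    have hfam : IsOrthonormalRootFamily J R e := ⟨h, he, fun i => (hd i).mem⟩
    have hcard := hfam.linearIndependent.fintype_card_le_finrank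
    rw [Fintype.card_fin] at hcard
    lia
  have hP0 : P 0 :=
    ⟨fun _ => α, fun i j => by fin_cases i; fin_cases j; simp [hα.unit], fun _ => hα⟩
  obtain ⟨e, he, hd⟩ := Nat.findGreatest_spec (Nat.zero_le (Module.finrank ℝ V)) hP0
  refine ⟨_, e, ⟨⟨h, he, fun i => (hd i).mem⟩, hd, fun γ hγ => ?_⟩⟩
  by_contra! horth
  have hP : P (Nat.findGreatest P (Module.finrank ℝ V) + 1) := by
    refine ⟨Fin.cons γ e, fun i j => ?_, Fin.cases hγ hd⟩
    cases i using Fin.cases <;> cases j using Fin.cases <;>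
      simp [hγ.unit, h.symm γ, horth, he, (Fin.succ_ne_zero _).symm]
  have hle := Nat.le_findGreatest (le_finrank hP) hP
  lia

namespace IsMaximalDoubledFamily

theorem exists_sub_smul_mem_ker (h : IsMaximalDoubledFamily J R e) {γ : V}
    (hγ : IsDoubled J R γ) :
    ∃ j, ∃ τ : ℝ, (τ = 1 ∨ τ = -1) ∧ γ - τ • e j ∈ LinearMap.ker J := by
  obtain ⟨j, hj⟩ := h.maximal γ hγ
  rcases h.apply_doubled (h.isDoubled j) hγ.mem with h0 | ⟨τ, hτ, hker | hker⟩ | ⟨h2, -⟩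
  · exact absurd h0 hj
  · exact ⟨j, τ, hτ, hker⟩
  · have hunit : (1 : ℝ) = 2 * τ * (2 * τ) := by
      rw [← hγ.unit, apply_eq_of_sub_mem_ker hker, h.symm, map_smul, apply_eq_of_sub_mem_ker hker]
      simp [(h.isDoubled j).unit]
    rcases hτ with rfl | rfl <;> norm_num at hunit
  · norm_num [hγ.unit] at h2

variable [Fintype ι]

theorem eq_zero_or_exists_coords (h : IsMaximalDoubledFamily J R e) {β : V} (hβ : β ∈ R) :
    (∀ i, J (e i) β = 0) ∨ ∃ v, IsBCVec v ∧ β - comb e v ∈ LinearMap.ker J := by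
  refine or_iff_not_imp_left.2 fun hne => ?_
  push Not at hne
  obtain ⟨i, hi⟩ := hne
  rcases h.apply_doubled (h.isDoubled i) hβ with h0 | ⟨σ, hσ, hker | hker⟩ | ⟨hββ, hσ⟩
  · exact absurd h0 hi
  · exact ⟨Pi.single i σ, Or.inl ⟨i, σ, hσ, rfl⟩, by rwa [comb_single]⟩
  · exact ⟨Pi.single i (2 * σ), Or.inr (Or.inr ⟨i, σ, hσ, rfl⟩), by rwa [comb_single]⟩
  -- `β` is a middle root: its reflection `e i - σ β` of `e i` is some `τ e j` modulo the kernel.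
  set σ := J (e i) β
  have hγ := (h.isDoubled i).sub_smul h.toIsSemidefRootSystem hβ (t := σ)
    (by rw [h.symm, hββ, mul_comm])
  obtain ⟨j, τ, hτ, hker⟩ := h.exists_sub_smul_mem_ker hγ
  have hij : i ≠ j := by
    rintro rfl
    have hpair := apply_eq_of_sub_mem_ker hker (e i)
    simp only [map_sub, map_smul, LinearMap.sub_apply, LinearMap.smul_apply, smul_eq_mul,
      h.symm β, (h.isDoubled i).unit] at hpair
    rcases hσ with hσ | hσ <;> rcases hτ with rfl | rfl <;> norm_num [σ, hσ] at hpair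
  have hστ : -(σ * τ) = 1 ∨ -(σ * τ) = -1 := by
    rcases hσ with hσ | hσ <;> rcases hτ with rfl | rfl <;> simp [hσ]
  refine ⟨_, Or.inr (Or.inl ⟨i, j, hij, σ, _, hσ, hστ, rfl⟩), ?_⟩
  have hσβ : β = (σ * σ) • β := by rcases hσ with hσ | hσ <;> simp [hσ]
  rw [map_add, comb_single, comb_single, hσβ]
  convert Submodule.smul_mem _ (-σ) hker using 1
  module

theorem exists_coords [Nonempty ι] (h : IsMaximalDoubledFamily J R e) :
    ∀ β ∈ R, ∃ v, IsBCVec v ∧ β - comb e v ∈ LinearMap.ker J := by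
  obtain ⟨i⟩ := ‹Nonempty ι›
  refine h.forall_of_orthogonal (h.short_mem i)
    ⟨Pi.single i 1, Or.inl ⟨i, 1, Or.inl rfl, rfl⟩, by simp⟩ ?_
  rintro x - ⟨v, -, hxv⟩ y hy hyP
  have hy0 := (h.eq_zero_or_exists_coords hy).resolve_right hyP
  rw [apply_eq_of_sub_mem_ker hxv, Fintype.linearCombination_apply]
  simp [hy0]

end IsMaximalDoubledFamily

variable [Fintype ι]

/-- An orthonormal family of roots exhibiting `R` modulo the kernel of the form as a system of
type `BC`, with the simple roots `e i` and `e i - e j` lifted to roots. -/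
structure IsBCFrame (J : LinearMap.BilinForm ℝ V) (R : Set V) (e : ι → V) : Prop
    extends IsOrthonormalRootFamily J R e where
  sub_mem : ∀ i j, i ≠ j → e i - e j ∈ R
  double : ∀ i, ∃ f ∈ R, f - (2 : ℝ) • e i ∈ LinearMap.ker J
  exists_coords : ∀ β ∈ R, ∃ v, IsBCVec v ∧ β - comb e v ∈ LinearMap.ker J

/-- All indices being linked, each `e j` is corrected by the root linking it to a fixed
`e i₀`. -/
theorem IsMaximalDoubledFamily.exists_correction [Nonempty ι] (h : IsMaximalDoubledFamily J R e) :
    ∃ r : ι → V, (∀ j, r j ∈ LinearMap.ker J) ∧ (∀ j, -r j ∈ fibre J R e (Pi.single j 1)) ∧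
      ∀ i j, i ≠ j → r j - r i ∈ fibre J R e (Pi.single i 1 - Pi.single j 1) := by
  let i₀ : ι := Classical.arbitrary ι
  have hlink (j : ι) : ∃ r ∈ LinearMap.ker J, (j = i₀ → r = 0) ∧
      (j ≠ i₀ → r ∈ fibre J R e (Pi.single i₀ 1 - Pi.single j 1)) := by
    rcases h.isLinked h.exists_coords i₀ j with rfl | ⟨r, hr⟩
    · exact ⟨0, zero_mem _, fun _ => rfl, fun hne => absurd rfl hne⟩
    · by_cases hj : j = i₀
      · exact ⟨0, zero_mem _, fun _ => rfl, fun hne => absurd hj hne⟩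
      · exact ⟨r, hr.1, fun hj' => absurd hj' hj, fun _ => hr⟩
  choose r hker hzero hmem using hlink
  refine ⟨r, hker, fun j => ?_, fun i j hij => ?_⟩
  · by_cases hj : j = i₀
    · simpa [hzero j hj] using h.zero_mem_fibre_single j
    · have hadd := h.add_smul_mem_fibre (h.zero_mem_fibre_single i₀) (hmem j hj) (t := -1)
        (by simp [hj, Ne.symm hj]; norm_num)
      simpa using hadd
  by_cases hi : i = i₀
  · subst hi
    simpa [hzero i₀ rfl] using hmem j hij.symm
  by_cases hj : j = i₀
  · have hneg := h.neg_mem_fibre_neg (hmem i hi)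
    rw [neg_sub] at hneg
    simpa [hzero i₀ rfl, hj] using hneg
  · have hadd := h.add_smul_mem_fibre (hmem j hj) (hmem i hi) (t := -1)
      (by simp [hi, Ne.symm hi, Ne.symm hj, hij.symm]; norm_num)
    rwa [neg_one_smul, neg_one_smul, ← sub_eq_add_neg, ← sub_eq_add_neg,
      sub_sub_sub_cancel_left] at hadd

theorem IsMaximalDoubledFamily.exists_isBCFrame [Nonempty ι] (h : IsMaximalDoubledFamily J R e) :
    ∃ e' : ι → V, IsBCFrame J R e' := by
  obtain ⟨r, hker, hshort, hsub⟩ := h.exists_correction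
  have hcongr (i : ι) : e i - r i - e i ∈ LinearMap.ker J := by
    rw [sub_sub_cancel_left]
    exact neg_mem (hker i)
  refine ⟨fun i => e i - r i, ⟨⟨h.toIsSemidefRootSystem, fun i j => ?_, fun i => ?_⟩,
    fun i j hij => ?_, fun i => ?_, fun β hβ => ?_⟩⟩
  · rw [apply_eq_of_sub_mem_ker (hcongr i), h.symm, apply_eq_of_sub_mem_ker (hcongr j), h.symm,
      h.orthonormal]
  · simpa [comb_single, sub_eq_add_neg] using (hshort i).2
  · convert (hsub i j hij).2 using 1
    rw [map_sub, comb_single, comb_single]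
    module
  · obtain ⟨f, hfR, hfe⟩ := (h.isDoubled i).double
    refine ⟨f, hfR, ?_⟩
    convert sub_mem hfe (Submodule.smul_mem _ 2 (hcongr i)) using 1
    module
  · obtain ⟨v, hv, hβv⟩ := h.exists_coords β hβ
    refine ⟨v, hv, ?_⟩
    convert add_mem hβv (Submodule.sum_mem _ fun i (_ : i ∈ Finset.univ) =>
      Submodule.smul_mem _ (v i) (hker i)) using 1
    simp only [comb, Fintype.linearCombination_apply, smul_sub, Finset.sum_sub_distrib]
    module

theorem exists_isBCFrame [FiniteDimensional ℝ V] (h : IsSemidefRootSystem J R) {α : V}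
    (hα : IsDoubled J R α) : ∃ (n : ℕ) (e : Fin (n + 1) → V), IsBCFrame J R e := by
  obtain ⟨n, e, he⟩ := exists_isMaximalDoubledFamily h hα
  exact ⟨n, he.exists_isBCFrame⟩

end Frames

section Reflections

variable {V : Type*} [AddCommGroup V] [Module ℝ V] {ι : Type*} [Fintype ι] [DecidableEq ι]
  {J : LinearMap.BilinForm ℝ V} {R : Set V} {e : ι → V}

namespace IsOrthonormalRootFamily

theorem eq_zero_of_comb_mem_ker (h : IsOrthonormalRootFamily J R e) {v : ι → ℝ}
    (hv : comb e v ∈ LinearMap.ker J) : v = 0 := funext fun i => by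
  rw [← h.apply_comb i v, h.apply_eq_zero_of_mem_ker_right hv, Pi.zero_apply]

theorem mem_fibre_single_neg (h : IsOrthonormalRootFamily J R e) {i : ι} {c : ℝ} {r : V}
    (hr : r ∈ fibre J R e (Pi.single i c)) : r ∈ fibre J R e (Pi.single i (-c)) := by
  convert h.mem_fibre_update_neg hr i using 2
  symm
  rw [Function.update_eq_iff]
  exact ⟨by simp, fun p hp => by simp [hp]⟩

theorem add_zsmul_mem_fibre_single (h : IsOrthonormalRootFamily J R e) {i : ι} {c d : ℝ}
    {r s : V} (hr : r ∈ fibre J R e (Pi.single i c)) (hs : s ∈ fibre J R e (Pi.single i d))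
    {t : ℤ} (ht : 2 * c = t * d) : r + t • s ∈ fibre J R e (Pi.single i c) := by
  have hmem := h.add_smul_mem_fibre (h.mem_fibre_single_neg hr) hs (t := t) (by
    simp only [single_dotProduct, Pi.single_eq_same]
    linear_combination -d * ht)
  have hc : -c + t * d = c := by linear_combination -ht
  rwa [Int.cast_smul_eq_zsmul ℝ t s, ← Pi.single_smul', ← Pi.single_add, smul_eq_mul, hc] at hmem

theorem add_zsmul_mem_fibre_single_add_single (h : IsOrthonormalRootFamily J R e) {i j : ι}
    (hij : i ≠ j) {d : ℝ} {m s : V}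
    (hm : m ∈ fibre J R e (Pi.single i 1 + Pi.single j 1))
    (hs : s ∈ fibre J R e (Pi.single i d)) {t : ℤ} (ht : 2 = t * d) :
    m + t • s ∈ fibre J R e (Pi.single i 1 + Pi.single j 1) := by
  have hm' := h.mem_fibre_single_add_single hij hm (σ' := -1) (τ' := 1) (by simp) (by simp)
  have hmem := h.add_smul_mem_fibre hm' hs (t := t) (by
    simp only [single_dotProduct, Pi.add_apply, Pi.single_eq_same, Pi.single_eq_of_ne hij]
    linear_combination -d * ht)
  have hd : -1 + t * d = 1 := by linear_combination -ht
  rwa [Int.cast_smul_eq_zsmul ℝ t s, ← Pi.single_smul', add_right_comm, ← Pi.single_add,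
    smul_eq_mul, hd] at hmem

end IsOrthonormalRootFamily

namespace IsBCFrame

theorem zero_mem_fibre_sub (h : IsBCFrame J R e) {i j : ι} (hij : i ≠ j) :
    (0 : V) ∈ fibre J R e (Pi.single i 1 - Pi.single j 1) :=
  ⟨zero_mem _, by simpa [comb_single] using h.sub_mem i j hij⟩

theorem mem_fibre_comp_swap (h : IsBCFrame J R e) {v : ι → ℝ} {r : V}
    (hr : r ∈ fibre J R e v) (i j : ι) : r ∈ fibre J R e (v ∘ Equiv.swap i j) := by
  rcases eq_or_ne i j with rfl | hij
  · simpa using hr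
  have hmem := h.add_smul_mem_fibre hr (h.zero_mem_fibre_sub hij) (t := v j - v i) (by
    simp [hij, hij.symm]; ring)
  rw [smul_zero, add_zero] at hmem
  convert hmem using 2
  ext p
  rcases eq_or_ne p i with rfl | hpi
  · simp [hij]
  rcases eq_or_ne p j with rfl | hpj
  · simp [hpi]
  · simp [hpi, hpj, Equiv.swap_apply_of_ne_of_ne]

theorem mem_fibre_single (h : IsBCFrame J R e) {i : ι} {c : ℝ} {r : V}
    (hr : r ∈ fibre J R e (Pi.single i c)) (j : ι) {d : ℝ} (hd : d = c ∨ d = -c) :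
    r ∈ fibre J R e (Pi.single j d) := by
  have hmem := h.mem_fibre_comp_swap hr i j
  rw [Pi.single_comp_equiv, Equiv.symm_swap, Equiv.swap_apply_left] at hmem
  rcases hd with rfl | rfl
  · exact hmem
  · exact h.mem_fibre_single_neg hmem

theorem mem_fibre_single_add_single_of_ne (h : IsBCFrame J R e) {i j p q : ι} (hij : i ≠ j)
    (hpq : p ≠ q) {c d : ℝ} {r : V} (hr : r ∈ fibre J R e (Pi.single i c + Pi.single j d)) :
    r ∈ fibre J R e (Pi.single p c + Pi.single q d) := by
  have move {i j : ι} (a b : ι) (hr : r ∈ fibre J R e (Pi.single i c + Pi.single j d)) :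
      r ∈ fibre J R e (Pi.single (Equiv.swap a b i) c + Pi.single (Equiv.swap a b j) d) := by
    have hmem := h.mem_fibre_comp_swap hr a b
    rwa [Pi.add_comp, Pi.single_comp_equiv, Pi.single_comp_equiv, Equiv.symm_swap] at hmem
  have hmem := move i p hr
  rw [Equiv.swap_apply_left] at hmem
  have hj : p ≠ Equiv.swap i p j := fun hp =>
    hij ((Equiv.swap i p).injective ((Equiv.swap_apply_left i p).trans hp))
  have hmem := move (Equiv.swap i p j) q hmem
  rwa [Equiv.swap_apply_left, Equiv.swap_apply_of_ne_of_ne hj hpq] at hmem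

theorem fibre_eq_of_isShortVec (h : IsBCFrame J R e) {v : ι → ℝ} (hv : IsShortVec v) (i : ι) :
    fibre J R e v = fibre J R e (Pi.single i 1) := by
  obtain ⟨j, σ, hσ, rfl⟩ := hv
  refine Set.Subset.antisymm (fun r hr => h.mem_fibre_single hr i ?_)
    fun r hr => h.mem_fibre_single hr j hσ
  rcases hσ with rfl | rfl <;> simp

theorem fibre_eq_of_isLongVec (h : IsBCFrame J R e) {v : ι → ℝ} (hv : IsLongVec v) (i : ι) :
    fibre J R e v = fibre J R e (Pi.single i 2) := by
  obtain ⟨j, σ, hσ, rfl⟩ := hv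
  refine Set.Subset.antisymm (fun r hr => h.mem_fibre_single hr i ?_)
    fun r hr => h.mem_fibre_single hr j ?_ <;>
  rcases hσ with rfl | rfl <;> simp

theorem fibre_eq_of_isMiddleVec (h : IsBCFrame J R e) {v : ι → ℝ} (hv : IsMiddleVec v)
    {i j : ι} (hij : i ≠ j) : fibre J R e v = fibre J R e (Pi.single i 1 + Pi.single j 1) := by
  obtain ⟨p, q, hpq, σ, τ, hσ, hτ, rfl⟩ := hv
  refine Set.Subset.antisymm (fun r hr => ?_) fun r hr => ?_
  · refine h.mem_fibre_single_add_single hij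
      (h.mem_fibre_single_add_single_of_ne hpq hij hr) ?_ ?_
    · rcases hσ with rfl | rfl <;> simp
    · rcases hτ with rfl | rfl <;> simp
  · exact h.mem_fibre_single_add_single hpq
      (h.mem_fibre_single_add_single_of_ne hij hpq hr) hσ hτ

theorem add_zsmul_mem_fibre_single_of_mem (h : IsBCFrame J R e) {i j : ι} (hij : i ≠ j) {c : ℤ}
    {r m : V} (hr : r ∈ fibre J R e (Pi.single i c))
    (hm : m ∈ fibre J R e (Pi.single i 1 + Pi.single j 1)) :
    r + c • m ∈ fibre J R e (Pi.single i c) := by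
  have hm' := h.mem_fibre_single_add_single hij hm (σ' := -1) (τ' := -1) (by simp) (by simp)
  have hmem := h.add_smul_mem_fibre hr hm' (t := c) (by simp [hij, hij.symm]; ring)
  refine h.mem_fibre_single (i := j) (c := -c) ?_ i (by simp)
  rw [Int.cast_smul_eq_zsmul ℝ c m] at hmem
  convert hmem using 2
  rw [smul_add, ← Pi.single_smul', ← Pi.single_smul', ← add_assoc, ← Pi.single_add]
  simp

end IsBCFrame

end Reflections

section TranslationTriples

variable {Λ : Type*} [AddCommGroup Λ]

/-- The closure properties which the reflections force on the sets `S`, `M`, `L` of translations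
of the short, middle and long roots. -/
structure IsTranslationTriple (S M L : Set Λ) : Prop where
  zero_mem_S : 0 ∈ S
  zero_mem_M : 0 ∈ M
  nonempty_L : L.Nonempty
  neg_S : ∀ s ∈ S, -s ∈ S
  S_add_S : ∀ s ∈ S, ∀ s' ∈ S, s + (2 : ℤ) • s' ∈ S
  S_add_M : ∀ s ∈ S, ∀ m ∈ M, s + m ∈ S
  S_add_L : ∀ s ∈ S, ∀ x ∈ L, s + x ∈ S
  M_add_S : ∀ m ∈ M, ∀ s ∈ S, m + (2 : ℤ) • s ∈ M
  M_add_L : ∀ m ∈ M, ∀ x ∈ L, m + x ∈ M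
  L_add_S : ∀ x ∈ L, ∀ s ∈ S, x + (4 : ℤ) • s ∈ L
  L_add_M : ∀ x ∈ L, ∀ m ∈ M, x + (2 : ℤ) • m ∈ L
  L_add_L : ∀ x ∈ L, ∀ y ∈ L, x + (2 : ℤ) • y ∈ L

namespace IsTranslationTriple

variable {S M L : Set Λ}

theorem M_subset (h : IsTranslationTriple S M L) : M ⊆ S := fun m hm => by
  simpa using h.S_add_M 0 h.zero_mem_S m hm

theorem L_subset (h : IsTranslationTriple S M L) : L ⊆ S := fun x hx => by
  simpa using h.S_add_L 0 h.zero_mem_S x hx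

end IsTranslationTriple

/-- With a single short coordinate there are no middle roots; the translations which would be
compatible with them play the role of `M`. -/
theorem isTranslationTriple_compatible {S L : Set Λ} (zero_mem_S : 0 ∈ S)
    (nonempty_L : L.Nonempty) (neg_S : ∀ s ∈ S, -s ∈ S)
    (S_add_S : ∀ s ∈ S, ∀ s' ∈ S, s + (2 : ℤ) • s' ∈ S) (S_add_L : ∀ s ∈ S, ∀ x ∈ L, s + x ∈ S)
    (L_add_S : ∀ x ∈ L, ∀ s ∈ S, x + (4 : ℤ) • s ∈ L)
    (L_add_L : ∀ x ∈ L, ∀ y ∈ L, x + (2 : ℤ) • y ∈ L) :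
    IsTranslationTriple S {m | (∀ s ∈ S, s + m ∈ S) ∧ ∀ x ∈ L, x + (2 : ℤ) • m ∈ L} L where
  zero_mem_S := zero_mem_S
  zero_mem_M := ⟨by simp, by simp⟩
  nonempty_L := nonempty_L
  neg_S := neg_S
  S_add_S := S_add_S
  S_add_M s hs m hm := hm.1 s hs
  S_add_L := S_add_L
  M_add_S m hm s hs := by
    refine ⟨fun s' hs' => ?_, fun x hx => ?_⟩
    · rw [← add_assoc]
      exact S_add_S _ (hm.1 s' hs') s hs
    · convert L_add_S _ (hm.2 x hx) s hs using 1
      module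
  M_add_L m hm x hx := by
    refine ⟨fun s hs => ?_, fun y hy => ?_⟩
    · rw [← add_assoc]
      exact S_add_L _ (hm.1 s hs) x hx
    · convert L_add_L _ (hm.2 y hy) x hx using 1
      module
  L_add_S := L_add_S
  L_add_M x hx m hm := hm.2 x hx
  L_add_L := L_add_L

end TranslationTriples

section Fibrations

variable {V : Type*} [AddCommGroup V] [Module ℝ V] {ι : Type*} [Fintype ι] [DecidableEq ι]
  {J : LinearMap.BilinForm ℝ V} {R : Set V} {e : ι → V}

/-- The roots are the short, middle and long combinations of `e`, translated respectively by `S`,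
`M` and `L`. -/
structure IsBCFibration (J : LinearMap.BilinForm ℝ V) (R : Set V) (e : ι → V)
    (S M L : Set V) : Prop extends IsBCFrame J R e, IsTranslationTriple S M L where
  short : ∀ v, IsShortVec v → fibre J R e v = S
  middle : ∀ v, IsMiddleVec v → fibre J R e v = M
  long : ∀ v, IsLongVec v → fibre J R e v = L

namespace IsBCFrame

theorem nonempty_fibre_single_two (h : IsBCFrame J R e) (i : ι) :
    (fibre J R e (Pi.single i 2)).Nonempty := by
  obtain ⟨f, hfR, hfe⟩ := h.double i
  exact ⟨_, hfe, by rw [comb_single, add_sub_cancel]; exact hfR⟩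

theorem neg_mem_fibre_single_one (h : IsBCFrame J R e) {i : ι} {r : V}
    (hr : r ∈ fibre J R e (Pi.single i 1)) : -r ∈ fibre J R e (Pi.single i 1) := by
  have hneg := h.neg_mem_fibre_neg hr
  rw [← Pi.single_neg] at hneg
  exact h.mem_fibre_single hneg i (by simp)

theorem exists_isBCFibration_of_subsingleton [Subsingleton ι] (h : IsBCFrame J R e) (i : ι) :
    ∃ S M L : Set V, IsBCFibration J R e S M L :=
  ⟨_, _, _,
    { h, isTranslationTriple_compatible (h.zero_mem_fibre_single i)
        (h.nonempty_fibre_single_two i) (fun _ => h.neg_mem_fibre_single_one)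
        (fun _ hs _ hs' => h.add_zsmul_mem_fibre_single hs hs' (by norm_num))
        (fun _ hs _ hx => by
          simpa using h.add_zsmul_mem_fibre_single hs hx (t := 1) (by norm_num))
        (fun _ hx _ hs => h.add_zsmul_mem_fibre_single hx hs (by norm_num))
        (fun _ hx _ hy => h.add_zsmul_mem_fibre_single hx hy (by norm_num)) with
      short := fun _ hv => h.fibre_eq_of_isShortVec hv i
      middle := fun _ ⟨p, q, hpq, _⟩ => absurd (Subsingleton.elim p q) hpq
      long := fun _ hv => h.fibre_eq_of_isLongVec hv i }⟩

theorem isBCFibration (h : IsBCFrame J R e) {i j : ι} (hij : i ≠ j) :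
    IsBCFibration J R e (fibre J R e (Pi.single i 1))
      (fibre J R e (Pi.single i 1 + Pi.single j 1)) (fibre J R e (Pi.single i 2)) where
  toIsBCFrame := h
  short _ hv := h.fibre_eq_of_isShortVec hv i
  middle _ hv := h.fibre_eq_of_isMiddleVec hv hij
  long _ hv := h.fibre_eq_of_isLongVec hv i
  zero_mem_S := h.zero_mem_fibre_single i
  zero_mem_M := by
    rw [← h.fibre_eq_of_isMiddleVec (v := Pi.single i 1 - Pi.single j 1) _ hij]
    · exact h.zero_mem_fibre_sub hij
    · exact ⟨i, j, hij, 1, -1, by simp, by simp, by rw [Pi.single_neg, sub_eq_add_neg]⟩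
  nonempty_L := h.nonempty_fibre_single_two i
  neg_S _ := h.neg_mem_fibre_single_one
  S_add_S _ hs _ hs' := h.add_zsmul_mem_fibre_single hs hs' (by norm_num)
  S_add_M s hs m hm := by
    simpa using h.add_zsmul_mem_fibre_single_of_mem hij (c := 1) (by simpa using hs) hm
  S_add_L _ hs _ hx := by
    simpa using h.add_zsmul_mem_fibre_single hs hx (t := 1) (by norm_num)
  M_add_S _ hm _ hs := h.add_zsmul_mem_fibre_single_add_single hij hm hs (by norm_num)
  M_add_L _ hm _ hx := by
    simpa using h.add_zsmul_mem_fibre_single_add_single hij hm hx (t := 1) (by norm_num)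
  L_add_S _ hx _ hs := h.add_zsmul_mem_fibre_single hx hs (by norm_num)
  L_add_M x hx m hm := by
    simpa using h.add_zsmul_mem_fibre_single_of_mem hij (c := 2) (by simpa using hx) hm
  L_add_L _ hx _ hy := h.add_zsmul_mem_fibre_single hx hy (by norm_num)

theorem exists_isBCFibration [Nonempty ι] (h : IsBCFrame J R e) :
    ∃ S M L : Set V, IsBCFibration J R e S M L := by
  rcases subsingleton_or_nontrivial ι with hι | ⟨i, j, hij⟩
  · exact h.exists_isBCFibration_of_subsingleton (Classical.arbitrary ι)
  · exact ⟨_, _, _, h.isBCFibration hij⟩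

end IsBCFrame

namespace IsBCFibration

variable {S M L : Set V}

theorem S_subset_ker [Nonempty ι] (h : IsBCFibration J R e S M L) : S ⊆ LinearMap.ker J := by
  rw [← h.short _ ⟨Classical.arbitrary ι, 1, Or.inl rfl, rfl⟩]
  exact fun s hs => hs.1

theorem S_subset_span [Nonempty ι] (h : IsBCFibration J R e S M L) :
    S ⊆ Submodule.span ℤ R := by
  let i : ι := Classical.arbitrary ι
  intro s hs
  rw [← h.short _ ⟨i, 1, Or.inl rfl, rfl⟩] at hs
  simpa [comb_single] using
    sub_mem (Submodule.subset_span (R := ℤ) hs.2) (Submodule.subset_span (h.short_mem i))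

theorem comb_add_mem_iff (h : IsBCFibration J R e S M L) {v : ι → ℝ} {r : V}
    (hr : r ∈ LinearMap.ker J) :
    comb e v + r ∈ R ↔
      (IsShortVec v ∧ r ∈ S) ∨ (IsMiddleVec v ∧ r ∈ M) ∨ (IsLongVec v ∧ r ∈ L) := by
  constructor
  · intro hvr
    obtain ⟨v', hv', hker⟩ := h.exists_coords _ hvr
    obtain rfl : v = v' := funext fun i => by
      rw [← h.apply_eq_of_sub_comb_mem hker i, map_add, h.apply_comb,
        h.apply_eq_zero_of_mem_ker_right hr, add_zero]
    have hfibre : r ∈ fibre J R e v := ⟨hr, hvr⟩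
    rcases hv' with hv | hv | hv
    · exact Or.inl ⟨hv, h.short v hv ▸ hfibre⟩
    · exact Or.inr (Or.inl ⟨hv, h.middle v hv ▸ hfibre⟩)
    · exact Or.inr (Or.inr ⟨hv, h.long v hv ▸ hfibre⟩)
  · rintro (⟨hv, hs⟩ | ⟨hv, hm⟩ | ⟨hv, hx⟩)
    · exact (h.short v hv ▸ hs : r ∈ fibre J R e v).2
    · exact (h.middle v hv ▸ hm : r ∈ fibre J R e v).2
    · exact (h.long v hv ▸ hx : r ∈ fibre J R e v).2

theorem exists_sub_comb_mem (h : IsBCFibration J R e S M L) {β : V} (hβ : β ∈ R) :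
    ∃ v, β - comb e v ∈ S := by
  obtain ⟨v, -, hker⟩ := h.exists_coords β hβ
  refine ⟨v, ?_⟩
  rcases (h.comb_add_mem_iff hker).1 (by rwa [add_sub_cancel]) with
    ⟨-, hs⟩ | ⟨-, hm⟩ | ⟨-, hx⟩
  · exact hs
  · exact h.M_subset hm
  · exact h.L_subset hx

section Span

variable (A : Type*) [Ring A] [Module A V] [SMul A ℝ] [IsScalarTower A ℝ V]

theorem span_le_sup_range_comb (h : IsBCFibration J R e S M L) :
    Submodule.span A R ≤ Submodule.span A S ⊔ (LinearMap.range (comb e)).restrictScalars A := by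
  refine Submodule.span_le.2 fun β hβ => ?_
  obtain ⟨v, hv⟩ := h.exists_sub_comb_mem hβ
  exact Submodule.mem_sup.2 ⟨_, Submodule.subset_span hv, comb e v, ⟨v, rfl⟩, sub_add_cancel _ _⟩

theorem mem_span_of_mem_ker [Nonempty ι] (h : IsBCFibration J R e S M L) {x : V}
    (hx : x ∈ Submodule.span A R) (hker : x ∈ LinearMap.ker J) : x ∈ Submodule.span A S := by
  obtain ⟨y, hy, -, ⟨v, rfl⟩, rfl⟩ := Submodule.mem_sup.1 (h.span_le_sup_range_comb A hx)
  have hle : Submodule.span A S ≤ (LinearMap.ker J).restrictScalars A :=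
    Submodule.span_le.2 h.S_subset_ker
  have hv : v = 0 :=
    h.eq_zero_of_comb_mem_ker ((Submodule.add_mem_iff_right _ (hle hy)).1 hker)
  simpa [hv] using hy

end Span

theorem span_S [Nonempty ι] (h : IsBCFibration J R e S M L) (hR : Submodule.span ℝ R = ⊤) :
    Submodule.span ℝ S = LinearMap.ker J :=
  le_antisymm (Submodule.span_le.2 h.S_subset_ker) fun _ hx =>
    h.mem_span_of_mem_ker ℝ (hR ▸ Submodule.mem_top) hx

theorem card_add_finrank_ker [FiniteDimensional ℝ V] [Nonempty ι]
    (h : IsBCFibration J R e S M L) (hR : Submodule.span ℝ R = ⊤) :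
    Fintype.card ι + Module.finrank ℝ (LinearMap.ker J) = Module.finrank ℝ V := by
  have hcompl : IsCompl (LinearMap.range (comb e)) (LinearMap.ker J) := by
    refine ⟨Submodule.disjoint_def.2 ?_, codisjoint_iff.2 (top_unique ?_)⟩
    · rintro - ⟨v, rfl⟩ hv
      rw [h.eq_zero_of_comb_mem_ker hv, map_zero]
    · rw [← hR, ← h.span_S hR, sup_comm]
      exact h.span_le_sup_range_comb ℝ
  rw [← Submodule.finrank_add_eq_of_isCompl hcompl,
    LinearMap.finrank_range_of_inj h.linearIndependent.fintypeLinearCombination_injective,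
    Module.finrank_fintype_fun_eq_card]

end IsBCFibration

end Fibrations

section Periods

variable {Λ : Type*} [AddCommGroup Λ]

theorem add_zsmul_mem_iff_of_mem_closure {T S : Set Λ} {k : ℤ}
    (hT : ∀ x ∈ T, ∀ s ∈ S, x + k • s ∈ T) (hS : ∀ s ∈ S, -s ∈ S) {y : Λ}
    (hy : y ∈ AddSubgroup.closure S) (x : Λ) : x + k • y ∈ T ↔ x ∈ T := by
  induction hy using AddSubgroup.closure_induction generalizing x with
  | mem s hs =>
    refine ⟨fun hx => ?_, fun hx => hT x hx s hs⟩
    simpa using hT _ hx _ (hS s hs)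
  | zero => simp
  | add y z _ _ hy hz => rw [smul_add, ← add_assoc, hz, hy]
  | neg y _ hy => rw [← hy, smul_neg, neg_add_cancel_right]

end Periods

section Parity

theorem exists_mem_odd_of_closure_eq_top {S : Set (ℤ × ℤ)} (hS : AddSubgroup.closure S = ⊤)
    {x y : ℤ} (hxy : Odd x ∨ Odd y) : ∃ p ∈ S, Odd (x * p.1 + y * p.2) := by
  by_contra! heven
  have hall (p : ℤ × ℤ) : Even (x * p.1 + y * p.2) := by
    have hp : p ∈ AddSubgroup.closure S := hS ▸ AddSubgroup.mem_top p
    induction hp using AddSubgroup.closure_induction with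
    | mem p hp => exact Int.not_odd_iff_even.1 (heven p hp)
    | zero => simp
    | add p q _ _ hp hq =>
      simpa only [Prod.fst_add, Prod.snd_add, mul_add, add_add_add_comm] using hp.add hq
    | neg p _ hp => simpa only [Prod.fst_neg, Prod.snd_neg, mul_neg, ← neg_add] using hp.neg
  rcases hxy with hx | hy
  · exact Int.not_even_iff_odd.2 hx (by simpa using hall (1, 0))
  · exact Int.not_even_iff_odd.2 hy (by simpa using hall (0, 1))

end Parity

section Classification

/-- The translation sets in coordinates along a basis of the lattice which they generate, for a
reduced root system which becomes non-reduced modulo the first basis vector. -/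
structure IsReducedTranslationTriple (S M L : Set (ℤ × ℤ)) : Prop
    extends IsTranslationTriple S M L where
  closure_S : AddSubgroup.closure S = ⊤
  reduced : ∀ m n, (m, n) ∈ S → (2 * m, 2 * n) ∉ L
  nonreduced : ∃ m n, (m, 2 * n) ∈ L

/-- The triple `(S, M, L)` becomes `(S₀, M₀, L₀)` after the change of basis `b ↦ b + t a` of the
lattice and a change of origin, by which the short, middle and long translations are shifted by
`(c₁, c₂)`, `0` and `2 (c₁, c₂)`. -/
def HasNormalForm (S M L S₀ M₀ L₀ : Set (ℤ × ℤ)) : Prop :=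
  ∃ c₁ c₂ t : ℤ, ∀ m n, ((m + t * n + c₁, n + c₂) ∈ S ↔ (m, n) ∈ S₀) ∧
    ((m + t * n, n) ∈ M ↔ (m, n) ∈ M₀) ∧
    ((m + t * n + 2 * c₁, n + 2 * c₂) ∈ L ↔ (m, n) ∈ L₀)

namespace IsReducedTranslationTriple

variable {S M L : Set (ℤ × ℤ)}

theorem mem_of_dvd (h : IsReducedTranslationTriple S M L) {T : Set (ℤ × ℤ)} {k : ℤ}
    (hT : ∀ x ∈ T, ∀ s ∈ S, x + k • s ∈ T) {m n p q : ℤ} (hm : k ∣ p - m) (hn : k ∣ q - n)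
    (hmn : (m, n) ∈ T) : (p, q) ∈ T := by
  obtain ⟨x, hx⟩ := hm
  obtain ⟨y, hy⟩ := hn
  have hmem := (add_zsmul_mem_iff_of_mem_closure hT h.neg_S
    (h.closure_S ▸ AddSubgroup.mem_top (x, y)) (m, n)).2 hmn
  simpa [← hx, ← hy] using hmem

theorem S_congr (h : IsReducedTranslationTriple S M L) {m n p q : ℤ} (hm : 2 ∣ p - m)
    (hn : 2 ∣ q - n) (hmn : (m, n) ∈ S) : (p, q) ∈ S :=
  h.mem_of_dvd h.S_add_S hm hn hmn

theorem M_congr (h : IsReducedTranslationTriple S M L) {m n p q : ℤ} (hm : 2 ∣ p - m)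
    (hn : 2 ∣ q - n) (hmn : (m, n) ∈ M) : (p, q) ∈ M :=
  h.mem_of_dvd h.M_add_S hm hn hmn

theorem L_congr (h : IsReducedTranslationTriple S M L) {m n p q : ℤ} (hm : 4 ∣ p - m)
    (hn : 4 ∣ q - n) (hmn : (m, n) ∈ L) : (p, q) ∈ L :=
  h.mem_of_dvd h.L_add_S hm hn hmn

/-- `S` contains `0` and generates, so it meets at least three of the four classes modulo two. -/
theorem dvd_sub_of_notMem_S (h : IsReducedTranslationTriple S M L) {m n p q : ℤ}
    (hmn : (m, n) ∉ S) (hpq : (p, q) ∉ S) : 2 ∣ m - p ∧ 2 ∣ n - q := by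
  by_contra hne
  have hmn0 : ¬(2 ∣ m ∧ 2 ∣ n) := fun hd =>
    hmn (h.S_congr (by simpa using hd.1) (by simpa using hd.2) h.zero_mem_S)
  have hpq0 : ¬(2 ∣ p ∧ 2 ∣ q) := fun hd =>
    hpq (h.S_congr (by simpa using hd.1) (by simpa using hd.2) h.zero_mem_S)
  obtain ⟨⟨x, y⟩, hxy, hodd⟩ := exists_mem_odd_of_closure_eq_top h.closure_S
    (x := n + q) (y := m + p) (by simp only [Int.odd_iff]; omega)
  have hmnx : ¬(2 ∣ m - x ∧ 2 ∣ n - y) := fun hd => hmn (h.S_congr hd.1 hd.2 hxy)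
  have hpqx : ¬(2 ∣ p - x ∧ 2 ∣ q - y) := fun hd => hpq (h.S_congr hd.1 hd.2 hxy)
  rw [Int.odd_add, Int.odd_mul, Int.even_mul] at hodd
  simp only [Int.odd_iff, Int.even_iff] at hodd
  omega

section MissingClass

variable {c₁ c₂ : ℤ}

theorem mem_S_iff_of_notMem (h : IsReducedTranslationTriple S M L) (hc : (c₁, c₂) ∉ S) (m n : ℤ) :
    (m, n) ∈ S ↔ ¬(2 ∣ m - c₁ ∧ 2 ∣ n - c₂) :=
  ⟨fun hs hd => hc (h.S_congr (by omega) (by omega) hs),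
    fun hd => by_contra fun hs => hd (h.dvd_sub_of_notMem_S hs hc)⟩

theorem two_dvd_of_forall_S_add_mem (h : IsReducedTranslationTriple S M L) (hc : (c₁, c₂) ∉ S)
    {m n : ℤ} (hmn : ∀ s ∈ S, s + (m, n) ∈ S) : 2 ∣ m ∧ 2 ∣ n := by
  by_contra hd
  have hmem := hmn (c₁ - m, c₂ - n) ((h.mem_S_iff_of_notMem hc _ _).2 (by omega))
  exact hc (by simpa using hmem)

theorem mem_M_iff_of_notMem (h : IsReducedTranslationTriple S M L) (hc : (c₁, c₂) ∉ S) (m n : ℤ) :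
    (m, n) ∈ M ↔ 2 ∣ m ∧ 2 ∣ n :=
  ⟨fun hm => h.two_dvd_of_forall_S_add_mem hc fun s hs => h.S_add_M s hs _ hm,
    fun hd => h.M_congr (by simpa using hd.1) (by simpa using hd.2) h.zero_mem_M⟩

theorem mem_L_iff_of_notMem (h : IsReducedTranslationTriple S M L) (hc : (c₁, c₂) ∉ S) (m n : ℤ) :
    (m, n) ∈ L ↔ 4 ∣ m - 2 * c₁ ∧ 4 ∣ n - 2 * c₂ := by
  have dvd_of_mem {m n : ℤ} (hmn : (m, n) ∈ L) : 4 ∣ m - 2 * c₁ ∧ 4 ∣ n - 2 * c₂ := by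
    obtain ⟨⟨m, rfl⟩, ⟨n, rfl⟩⟩ :=
      h.two_dvd_of_forall_S_add_mem hc fun s hs => h.S_add_L s hs _ hmn
    have hS : (m, n) ∉ S := fun hs => h.reduced m n hs hmn
    rw [h.mem_S_iff_of_notMem hc, not_not] at hS
    omega
  obtain ⟨x, y, hxy⟩ := h.nonreduced
  have hd := dvd_of_mem hxy
  exact ⟨dvd_of_mem, fun hmn => h.L_congr (by omega) (by omega) hxy⟩

theorem hasNormalForm_of_notMem (h : IsReducedTranslationTriple S M L) (hc : (c₁, c₂) ∉ S) :
    HasNormalForm S M L {p | Odd p.1 ∨ Odd p.2} {p | 2 ∣ p.1 ∧ 2 ∣ p.2}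
      {p | 4 ∣ p.1 ∧ 4 ∣ p.2} := by
  refine ⟨c₁, c₂, 0, fun m n => ?_⟩
  simp only [h.mem_S_iff_of_notMem hc, h.mem_M_iff_of_notMem hc, h.mem_L_iff_of_notMem hc,
    Set.mem_ofPred_eq, Int.odd_iff]
  omega

end MissingClass

section Full

variable (h : IsReducedTranslationTriple S M L) (hS : S = Set.univ)

include h hS

theorem not_two_dvd_of_mem_L {m n : ℤ} (hmn : (m, n) ∈ L) : ¬(2 ∣ m ∧ 2 ∣ n) := by
  rintro ⟨⟨m, rfl⟩, ⟨n, rfl⟩⟩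
  exact h.reduced m n (hS ▸ Set.mem_univ _) hmn

theorem exists_odd_mem_L : ∃ m n, ¬2 ∣ m ∧ (m, 2 * n) ∈ L := by
  obtain ⟨m, n, hmn⟩ := h.nonreduced
  exact ⟨m, n, fun hm => h.not_two_dvd_of_mem_L hS hmn ⟨hm, by omega⟩, hmn⟩

theorem mem_L_of_two_dvd_of_four_dvd {m n p q : ℤ} (hm : 2 ∣ p - m) (hn : 4 ∣ q - n)
    (hmn : (m, n) ∈ L) : (p, q) ∈ L := by
  obtain ⟨x, y, hx, hxy⟩ := h.exists_odd_mem_L hS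
  by_cases hm4 : 4 ∣ p - m
  · exact h.L_congr hm4 hn hmn
  · exact h.L_congr (m := m + 2 * x) (n := n + 2 * (2 * y)) (by omega) (by omega)
      (h.L_add_L _ hmn _ hxy)

theorem mem_M_of_two_dvd_sub {m n p q : ℤ} (hn : 2 ∣ q - n) (hmn : (m, n) ∈ M) :
    (p, q) ∈ M := by
  obtain ⟨x, y, hx, hxy⟩ := h.exists_odd_mem_L hS
  by_cases hm : 2 ∣ p - m
  · exact h.M_congr hm hn hmn
  · exact h.M_congr (m := m + x) (n := n + 2 * y) (by omega) (by omega) (h.M_add_L _ hmn _ hxy)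

theorem M_eq_univ_or : M = Set.univ ∨ M = {p | 2 ∣ p.2} := by
  by_cases hM : ∃ m n, ¬2 ∣ n ∧ (m, n) ∈ M
  · obtain ⟨x, y, hy, hxy⟩ := hM
    refine Or.inl (Set.eq_univ_of_forall fun ⟨m, n⟩ => ?_)
    by_cases hn : 2 ∣ n
    · exact h.mem_M_of_two_dvd_sub hS (by simpa using hn) h.zero_mem_M
    · exact h.mem_M_of_two_dvd_sub hS (by omega) hxy
  · push Not at hM
    refine Or.inr (Set.ext fun ⟨m, n⟩ => ⟨fun hmn => ?_, fun hn => ?_⟩)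
    · exact by_contra fun hn => hM m n hn hmn
    · exact h.mem_M_of_two_dvd_sub hS (by simpa using hn) h.zero_mem_M

section MiddleFull

variable (hM : M = Set.univ)

include hM

theorem mem_L_iff_of_M_eq_univ (m n : ℤ) :
    (m, n) ∈ L ↔ (Odd m ∧ Even n) ∨ (Even m ∧ Odd n ∧ (0, 1) ∈ L) ∨
      (Odd m ∧ Odd n ∧ (1, 1) ∈ L) := by
  have L_congr_two {m n p q : ℤ} (hm : 2 ∣ p - m) (hn : 2 ∣ q - n) (hmn : (m, n) ∈ L) :
      (p, q) ∈ L := by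
    obtain ⟨x, hx⟩ := hm
    obtain ⟨y, hy⟩ := hn
    simpa [← hx, ← hy] using h.L_add_M _ hmn (x, y) (hM ▸ Set.mem_univ _)
  obtain ⟨x, y, hx, hxy⟩ := h.exists_odd_mem_L hS
  simp only [Int.odd_iff, Int.even_iff]
  constructor
  · intro hmn
    have hne := h.not_two_dvd_of_mem_L hS hmn
    by_cases hn : 2 ∣ n
    · exact Or.inl (by omega)
    by_cases hm : 2 ∣ m
    · exact Or.inr (Or.inl ⟨by omega, by omega, L_congr_two (by omega) (by omega) hmn⟩)
    · exact Or.inr (Or.inr ⟨by omega, by omega, L_congr_two (by omega) (by omega) hmn⟩)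
  · rintro (hmn | ⟨hm, hn, h01⟩ | ⟨hm, hn, h11⟩)
    · exact L_congr_two (by omega) (by omega) hxy
    · exact L_congr_two (by omega) (by omega) h01
    · exact L_congr_two (by omega) (by omega) h11

theorem hasNormalForm_of_M_eq_univ :
    HasNormalForm S M L Set.univ Set.univ {p | Odd p.1} ∨
      HasNormalForm S M L Set.univ Set.univ {p | Odd p.1 ∧ 2 ∣ p.2} ∨
      HasNormalForm S M L Set.univ Set.univ {p | Odd p.1 ∨ Odd p.2} := by
  have hL := h.mem_L_iff_of_M_eq_univ hS hM
  subst hS hM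
  generalize ((0, 1) ∈ L) = Has01 at hL
  generalize ((1, 1) ∈ L) = Has11 at hL
  by_cases h01 : Has01 <;> by_cases h11 : Has11
  · refine Or.inr (Or.inr ⟨0, 0, 0, fun m n => ?_⟩)
    simp only [hL, h01, h11, Set.mem_univ, Set.mem_ofPred_eq, Int.odd_iff, Int.even_iff, and_true,
      true_and]
    omega
  · refine Or.inl ⟨0, 0, 1, fun m n => ?_⟩
    simp only [hL, h01, h11, Set.mem_univ, Set.mem_ofPred_eq, Int.odd_iff, Int.even_iff, and_true,
      and_false, or_false, true_and]
    omega
  · refine Or.inl ⟨0, 0, 0, fun m n => ?_⟩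
    simp only [hL, h01, h11, Set.mem_univ, Set.mem_ofPred_eq, Int.odd_iff, Int.even_iff, and_true,
      and_false, false_or, true_and]
    omega
  · refine Or.inr (Or.inl ⟨0, 0, 0, fun m n => ?_⟩)
    simp only [hL, h01, h11, Set.mem_univ, Set.mem_ofPred_eq, Int.odd_iff, Int.even_iff, and_false,
      or_false, true_and]
    omega

end MiddleFull

theorem exists_mem_L_iff_of_M_eq (hM : M = {p | 2 ∣ p.2}) :
    ∃ c : ℤ, ∀ m n, (m, n) ∈ L ↔
      Odd m ∧ (4 ∣ n - 2 * c ∨ 4 ∣ n - 2 * c - 2 ∧ (1, 2 * c + 2) ∈ L) := by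
  obtain ⟨x, c, hx, hxc⟩ := h.exists_odd_mem_L hS
  refine ⟨c, fun m n => ?_⟩
  simp only [Int.odd_iff]
  constructor
  · intro hmn
    have hne := h.not_two_dvd_of_mem_L hS hmn
    have hn : (m, n) ∈ M := by simpa using h.M_add_L _ h.zero_mem_M _ hmn
    rw [hM, Set.mem_ofPred_eq] at hn
    refine ⟨by omega, or_iff_not_imp_left.2 fun hn4 => ⟨by omega, ?_⟩⟩
    exact h.mem_L_of_two_dvd_of_four_dvd hS (by omega) (by omega) hmn
  · rintro ⟨hm, hn | ⟨hn, hmem⟩⟩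
    · exact h.mem_L_of_two_dvd_of_four_dvd hS (by omega) hn hxc
    · exact h.mem_L_of_two_dvd_of_four_dvd hS (by omega) (by omega) hmem

theorem hasNormalForm_of_M_eq (hM : M = {p | 2 ∣ p.2}) :
    HasNormalForm S M L Set.univ {p | 2 ∣ p.2} {p | Odd p.1 ∧ 4 ∣ p.2} ∨
      HasNormalForm S M L Set.univ {p | 2 ∣ p.2} {p | Odd p.1 ∧ 2 ∣ p.2} := by
  obtain ⟨c, hL⟩ := h.exists_mem_L_iff_of_M_eq hS hM
  subst hS hM
  generalize ((1, 2 * c + 2) ∈ L) = HasNext at hL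
  by_cases hc : HasNext
  · refine Or.inr ⟨0, c, 0, fun m n => ?_⟩
    simp only [hL, hc, Set.mem_univ, Set.mem_ofPred_eq, Int.odd_iff, and_true,
      true_and]
    omega
  · refine Or.inl ⟨0, c, 0, fun m n => ?_⟩
    simp only [hL, hc, Set.mem_univ, Set.mem_ofPred_eq, Int.odd_iff, and_false,
      or_false, true_and]
    omega

end Full

theorem hasNormalForm (h : IsReducedTranslationTriple S M L) :
    (∃ X : AffineType, HasNormalForm S M L Set.univ {p | X.middleStep ∣ p.2}
      {p | Odd p.1 ∧ X.longStep ∣ p.2}) ∨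
    HasNormalForm S M L Set.univ Set.univ {p | Odd p.1 ∨ Odd p.2} ∨
    HasNormalForm S M L {p | Odd p.1 ∨ Odd p.2} {p | 2 ∣ p.1 ∧ 2 ∣ p.2}
      {p | 4 ∣ p.1 ∧ 4 ∣ p.2} := by
  by_cases hS : S = Set.univ
  · rcases h.M_eq_univ_or hS with hM | hM
    · rcases h.hasNormalForm_of_M_eq_univ hS hM with hBCC | hBBvee | hstar
      · exact Or.inl ⟨.BCC, by simpa [AffineType.middleStep, AffineType.longStep] using hBCC⟩
      · exact Or.inl ⟨.BBvee, by simpa [AffineType.middleStep, AffineType.longStep] using hBBvee⟩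
      · exact Or.inr (Or.inl hstar)
    · rcases h.hasNormalForm_of_M_eq hS hM with hCveeBC | hCveeC
      · exact Or.inl ⟨.CveeBC, hCveeBC⟩
      · exact Or.inl ⟨.CveeC, hCveeC⟩
  · obtain ⟨⟨c₁, c₂⟩, hc⟩ := (Set.ne_univ_iff_exists_notMem S).1 hS
    exact Or.inr (Or.inr (h.hasNormalForm_of_notMem hc))

end IsReducedTranslationTriple

end Classification

/-- The homomorphism `(m, n) ↦ m u + n w`. -/
def intComb {Λ : Type*} [AddCommGroup Λ] (u w : Λ) : ℤ × ℤ →+ Λ :=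
  (zmultiplesHom Λ u).coprod (zmultiplesHom Λ w)

theorem intComb_apply {Λ : Type*} [AddCommGroup Λ] (u w : Λ) (p : ℤ × ℤ) :
    intComb u w p = p.1 • u + p.2 • w := rfl

section Models

variable {l : ℕ}

theorem bcShort_eq (l : ℕ) : bcShort l = {x | IsShortVec x.1 ∧ x.2 = 0} := by
  ext ⟨v, r⟩
  constructor
  · rintro ⟨i, h | h⟩ <;> obtain ⟨rfl, rfl⟩ := Prod.ext_iff.1 h
    · exact ⟨⟨i, 1, Or.inl rfl, rfl⟩, rfl⟩
    · exact ⟨⟨i, -1, Or.inr rfl, (Pi.single_neg i 1).symm⟩, neg_zero⟩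
  · rintro ⟨⟨i, σ, rfl | rfl, hv⟩, hr⟩
    · exact ⟨i, Or.inl (Prod.ext hv hr)⟩
    · exact ⟨i, Or.inr (Prod.ext (hv.trans (Pi.single_neg i 1)) (hr.trans neg_zero.symm))⟩

theorem bcLong_eq (l : ℕ) : bcLong l = {x | IsLongVec x.1 ∧ x.2 = 0} := by
  have two_smul_ε (i : Fin l) : (2 : ℝ) • ε l i = (Pi.single i 2, 0) := by
    simp [ε, ← Pi.single_smul]
  ext ⟨v, r⟩
  simp only [bcLong, IsLongVec, two_smul_ε, Set.mem_ofPred_eq]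
  constructor
  · rintro ⟨i, h | h⟩ <;> obtain ⟨rfl, rfl⟩ := Prod.ext_iff.1 h
    · exact ⟨⟨i, 1, Or.inl rfl, by simp⟩, rfl⟩
    · exact ⟨⟨i, -1, Or.inr rfl, by simp [Pi.single_neg]⟩, by simp⟩
  · rintro ⟨⟨i, σ, rfl | rfl, rfl⟩, rfl⟩
    · exact ⟨i, Or.inl (by simp)⟩
    · exact ⟨i, Or.inr (by simp [Pi.single_neg])⟩

theorem smul_ε_add_smul_ε_mem_bcMiddle {i j : Fin l} (hij : i < j) {σ τ : ℝ}
    (hσ : σ = 1 ∨ σ = -1) (hτ : τ = 1 ∨ τ = -1) : σ • ε l i + τ • ε l j ∈ bcMiddle l := by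
  refine ⟨i, j, hij, ?_⟩
  rcases hσ with rfl | rfl <;> rcases hτ with rfl | rfl
  · exact Or.inl (by module)
  · exact Or.inr (Or.inr (Or.inl (by module)))
  · exact Or.inr (Or.inr (Or.inr (by module)))
  · exact Or.inr (Or.inl (by module))

theorem bcMiddle_eq (l : ℕ) : bcMiddle l = {x | IsMiddleVec x.1 ∧ x.2 = 0} := by
  ext x
  constructor
  · rintro ⟨i, j, hij, rfl | rfl | rfl | rfl⟩
    · exact ⟨⟨i, j, hij.ne, 1, 1, by simp, by simp, by simp [ε]⟩, by simp [ε]⟩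
    · exact ⟨⟨i, j, hij.ne, -1, -1, by simp, by simp, by simp [ε, Pi.single_neg, add_comm]⟩,
        by simp [ε]⟩
    · exact ⟨⟨i, j, hij.ne, 1, -1, by simp, by simp, by simp [ε, Pi.single_neg, sub_eq_add_neg]⟩,
        by simp [ε]⟩
    · exact ⟨⟨i, j, hij.ne, -1, 1, by simp, by simp,
        by simp [ε, Pi.single_neg, sub_eq_add_neg, add_comm]⟩, by simp [ε]⟩
  · rintro ⟨⟨i, j, hij, σ, τ, hσ, hτ, hv⟩, hr⟩
    have hx : x = σ • ε l i + τ • ε l j :=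
      Prod.ext (by simpa [ε, ← Pi.single_smul] using hv) (by simpa [ε] using hr)
    rcases lt_or_gt_of_ne hij with hlt | hlt
    · exact hx ▸ smul_ε_add_smul_ε_mem_bcMiddle hlt hσ hτ
    · exact hx ▸ add_comm (τ • ε l j) (σ • ε l i) ▸ smul_ε_add_smul_ε_mem_bcMiddle hlt hτ hσ

/-- The roots of type `BC` whose short, middle and long vectors are translated by the vectors
`m a + n b` with `(m, n)` in `S`, `M` and `L` respectively. -/
def bcSystem (l : ℕ) (S M L : Set (ℤ × ℤ)) : Set (Space l) :=
  (bcShort l + intComb (a l) (b l) '' S) ∪ (bcMiddle l + intComb (a l) (b l) '' M) ∪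
    (bcLong l + intComb (a l) (b l) '' L)

theorem mem_add_intComb_image_iff {A : Set (Space l)} {P : (Fin l → ℝ) → Prop}
    (hA : A = {x | P x.1 ∧ x.2 = 0}) {T : Set (ℤ × ℤ)} {x : Space l} :
    x ∈ A + intComb (a l) (b l) '' T ↔
      ∃ m n : ℤ, x.2 = ((m : ℝ), (n : ℝ)) ∧ P x.1 ∧ (m, n) ∈ T := by
  have intComb_eq (p : ℤ × ℤ) : intComb (a l) (b l) p = (0, ((p.1 : ℝ), (p.2 : ℝ))) := by
    simp [intComb_apply, a, b]
  rw [hA]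
  constructor
  · rintro ⟨⟨v, r⟩, ⟨hv, rfl : r = 0⟩, -, ⟨⟨m, n⟩, hmn, rfl⟩, rfl⟩
    exact ⟨m, n, by simp [intComb_eq], by simpa [intComb_eq] using hv, hmn⟩
  · rintro ⟨m, n, hx, hv, hmn⟩
    exact ⟨(x.1, 0), ⟨hv, rfl⟩, _, ⟨(m, n), hmn, rfl⟩, Prod.ext (by simp [intComb_eq])
      (by simp [intComb_eq, hx])⟩

theorem mem_bcSystem_iff {S M L : Set (ℤ × ℤ)} {x : Space l} :
    x ∈ bcSystem l S M L ↔ ∃ m n : ℤ, x.2 = ((m : ℝ), (n : ℝ)) ∧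
      ((IsShortVec x.1 ∧ (m, n) ∈ S) ∨ (IsMiddleVec x.1 ∧ (m, n) ∈ M) ∨
        (IsLongVec x.1 ∧ (m, n) ∈ L)) := by
  simp only [bcSystem, Set.mem_union, mem_add_intComb_image_iff (bcShort_eq l),
    mem_add_intComb_image_iff (bcMiddle_eq l), mem_add_intComb_image_iff (bcLong_eq l), or_assoc,
    and_or_left, exists_or]

theorem bcSystem_congr_middle_of_lt_two (hl : l < 2) (S M M' L : Set (ℤ × ℤ)) :
    bcSystem l S M L = bcSystem l S M' L := by
  have not_isMiddleVec (v : Fin l → ℝ) : ¬IsMiddleVec v := by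
    rintro ⟨i, j, hij, -⟩
    exact hij (Fin.ext (by omega))
  ext x
  simp only [mem_bcSystem_iff, not_isMiddleVec, false_and]

theorem zmul_b_add_zmul_a (k j : ℤ) :
    zmul k (b l) + zmul j (a l) = intComb (a l) (b l) '' {p | j ∣ p.1 ∧ k ∣ p.2} := by
  ext x
  constructor
  · rintro ⟨-, ⟨n, rfl⟩, -, ⟨m, rfl⟩, rfl⟩
    exact ⟨(j * m, k * n), ⟨dvd_mul_right j m, dvd_mul_right k n⟩,
      (intComb_apply _ _ _).trans (by simp [add_comm])⟩
  · rintro ⟨⟨p, q⟩, ⟨⟨m, hm : p = j * m⟩, ⟨n, hn : q = k * n⟩⟩, rfl⟩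
    exact ⟨_, ⟨n, rfl⟩, _, ⟨m, rfl⟩, by simp [intComb_apply, hm, hn, add_comm]⟩

theorem zmul_b_add_oddA (k : ℤ) :
    zmul k (b l) + oddA l = intComb (a l) (b l) '' {p | Odd p.1 ∧ k ∣ p.2} := by
  ext x
  constructor
  · rintro ⟨-, ⟨n, rfl⟩, -, ⟨m, rfl⟩, rfl⟩
    exact ⟨(1 + 2 * m, k * n), ⟨⟨m, add_comm _ _⟩, dvd_mul_right k n⟩,
      (intComb_apply _ _ _).trans (by simp [add_comm])⟩
  · rintro ⟨⟨p, q⟩, ⟨⟨m, hm : p = 2 * m + 1⟩, ⟨n, hn : q = k * n⟩⟩, rfl⟩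
    exact ⟨_, ⟨n, rfl⟩, _, ⟨m, rfl⟩, by simp [intComb_apply, hm, hn, add_comm]⟩

theorem L11_eq (l : ℕ) : L11 l = intComb (a l) (b l) '' {p | Odd p.1 ∨ Odd p.2} := by
  have mul_modEq_zero_iff (m n : ℤ) : (m - 1) * (n - 1) ≡ 0 [ZMOD 2] ↔ Odd m ∨ Odd n := by
    rw [Int.modEq_zero_iff_dvd, Int.prime_two.dvd_mul, Int.odd_iff, Int.odd_iff]
    omega
  ext x
  simp only [L11, mul_modEq_zero_iff, Set.mem_image, Set.mem_ofPred_eq, Prod.exists,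
    intComb_apply, eq_comm]

theorem reducedClassical_eq_bcSystem (X : AffineType) :
    reducedClassical l X = bcSystem l Set.univ {p | X.middleStep ∣ p.2}
      {p | Odd p.1 ∧ X.longStep ∣ p.2} := by
  simp [reducedClassical, affShort, affMiddle, affLong, add_assoc, zmul_b_add_zmul_a,
    zmul_b_add_oddA, bcSystem]

theorem BC11star_eq_bcSystem :
    BC11star l = bcSystem l Set.univ Set.univ {p | Odd p.1 ∨ Odd p.2} := by
  simp [BC11star, affShort, affMiddle, AffineType.middleStep, add_assoc, zmul_b_add_zmul_a,
    L11_eq, bcSystem]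

theorem BC44star_eq_bcSystem :
    BC44star l = bcSystem l {p | Odd p.1 ∨ Odd p.2} {p | 2 ∣ p.1 ∧ 2 ∣ p.2}
      {p | 4 ∣ p.1 ∧ 4 ∣ p.2} := by
  simp only [BC44star, affMiddle, affLong, AffineType.middleStep, AffineType.longStep, add_assoc,
    zmul_b_add_zmul_a, L11_eq, bcSystem]

end Models

section LatticeBases

theorem exists_basis_eq_smul {A M ι : Type*} [CommRing A] [IsDomain A] [IsPrincipalIdealRing A]
    [AddCommGroup M] [Module A M] [Finite ι] (B : Module.Basis ι A M) (i : ι) (g : M) :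
    ∃ (B' : Module.Basis ι A M) (d : A), g = d • B' i := by
  classical
  have : Module.IsTorsionFree A M := B.isTorsionFree
  by_cases hg : g = 0
  · exact ⟨B, 0, by simp [hg]⟩
  obtain ⟨n, BM, BN, f, c, hsnf⟩ := (Submodule.span A {g}).smithNormalForm B
  have hn : n = 1 := by
    have hrank := (LinearEquiv.toSpanNonzeroSingleton A M g hg).finrank_eq
    rwa [Module.finrank_self, Module.finrank_eq_card_basis BN, Fintype.card_fin, eq_comm] at hrank
  subst hn
  have hgN := congrArg Subtype.val (BN.sum_repr ⟨g, Submodule.mem_span_singleton_self g⟩)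
  rw [Fin.sum_univ_one, Submodule.coe_smul, hsnf, smul_smul] at hgN
  exact ⟨BM.reindex (Equiv.swap (f 0) i), _, by simpa using hgN.symm⟩

variable {V : Type*} [AddCommGroup V] [Module ℝ V] {S : Set V} {u w : V}

/-- The vectors `u` and `w` form a basis of the lattice generated by `S`. -/
structure IsLatticeBasis (S : Set V) (u w : V) : Prop where
  linearIndependent : LinearIndependent ℝ ![u, w]
  range_intComb : (intComb u w).range = AddSubgroup.closure S

theorem linearIndependent_of_range_intComb
    (hrange : (intComb u w).range = AddSubgroup.closure S)
    (hrank : Module.finrank ℝ (Submodule.span ℝ S) = 2) : LinearIndependent ℝ ![u, w] := by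
  rw [linearIndependent_iff_card_le_finrank_span, Fintype.card_fin]
  have : Module.Finite ℝ (Submodule.span ℝ (Set.range ![u, w])) :=
    Module.Finite.span_of_finite ℝ (Set.finite_range _)
  refine hrank.ge.trans (Submodule.finrank_mono (Submodule.span_le.2 fun s hs => ?_))
  obtain ⟨p, rfl⟩ := hrange ▸ AddSubgroup.subset_closure hs
  have hu : u ∈ Submodule.span ℝ (Set.range ![u, w]) := Submodule.subset_span ⟨0, rfl⟩
  have hw : w ∈ Submodule.span ℝ (Set.range ![u, w]) := Submodule.subset_span ⟨1, rfl⟩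
  exact add_mem (zsmul_mem hu _) (zsmul_mem hw _)

theorem exists_isLatticeBasis {F : Type*} [NormedAddCommGroup F] [NormedSpace ℝ F]
    [FiniteDimensional ℝ F] {S : Set F} {g : F}
    (hS : DiscreteTopology (Submodule.span ℤ S))
    (hrank : Module.finrank ℝ (Submodule.span ℝ S) = 2) (hg0 : g ≠ 0)
    (hg : g ∈ Submodule.span ℤ S) :
    ∃ u w, IsLatticeBasis S u w ∧ Submodule.span ℝ {u} = Submodule.span ℝ {g} := by
  have hrankℤ : Module.finrank ℤ (Submodule.span ℤ S) = 2 :=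
    (Real.finrank_eq_int_finrank_of_discrete hS).symm.trans hrank
  obtain ⟨B, d, hgB⟩ := exists_basis_eq_smul
    (Module.finBasisOfFinrankEq ℤ (Submodule.span ℤ S) hrankℤ) 0 ⟨g, hg⟩
  replace hgB : g = (d : ℝ) • (B 0 : F) := by
    simpa [Int.cast_smul_eq_zsmul] using congrArg Subtype.val hgB
  have hrange : (intComb (B 0 : F) (B 1 : F)).range = AddSubgroup.closure S := by
    rw [← Submodule.span_int_eq_addSubgroupClosure]
    ext r
    constructor
    · rintro ⟨p, rfl⟩
      exact add_mem (zsmul_mem (B 0).2 _) (zsmul_mem (B 1).2 _)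
    · intro hr
      refine ⟨(B.repr ⟨r, hr⟩ 0, B.repr ⟨r, hr⟩ 1), ?_⟩
      have hsum := congrArg Subtype.val (B.sum_repr ⟨r, hr⟩)
      rwa [Fin.sum_univ_two] at hsum
  have hd : (d : ℝ) ≠ 0 := fun hd => hg0 (by rw [hgB, hd, zero_smul])
  exact ⟨B 0, B 1, ⟨linearIndependent_of_range_intComb hrange hrank, hrange⟩,
    by rw [hgB, Submodule.span_singleton_smul_eq hd.isUnit]⟩

namespace IsLatticeBasis

variable (h : IsLatticeBasis S u w)
include h

theorem subset_range : S ⊆ Set.range (intComb u w) := by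
  rw [← AddMonoidHom.coe_range, h.range_intComb]
  exact AddSubgroup.subset_closure

theorem intComb_mem_closure (p : ℤ × ℤ) : intComb u w p ∈ AddSubgroup.closure S :=
  h.range_intComb ▸ AddMonoidHom.mem_range.2 ⟨p, rfl⟩

theorem left_mem_closure : u ∈ AddSubgroup.closure S := by
  simpa [intComb_apply] using h.intComb_mem_closure (1, 0)

theorem right_mem_closure : w ∈ AddSubgroup.closure S := by
  simpa [intComb_apply] using h.intComb_mem_closure (0, 1)

theorem eq_and_eq_of_smul_add_smul_eq {x y x' y' : ℝ}
    (heq : x • u + y • w = x' • u + y' • w) : x = x' ∧ y = y' := by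
  have hzero : (x - x') • u + (y - y') • w = 0 := by
    rw [sub_smul, sub_smul, sub_add_sub_comm, heq, sub_self]
  simpa only [sub_eq_zero] using LinearIndependent.pair_iff.1 h.linearIndependent _ _ hzero

theorem closure_preimage : AddSubgroup.closure (intComb u w ⁻¹' S) = ⊤ := by
  have hinj : Function.Injective (intComb u w) := fun p q hpq => by
    simp only [intComb_apply, ← Int.cast_smul_eq_zsmul ℝ] at hpq
    obtain ⟨hfst, hsnd⟩ := h.eq_and_eq_of_smul_add_smul_eq hpq
    exact Prod.ext (mod_cast hfst) (mod_cast hsnd)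
  rw [← AddSubgroup.map_injective hinj |>.eq_iff, AddMonoidHom.map_closure,
    Set.image_preimage_eq_of_subset h.subset_range, ← h.range_intComb, AddMonoidHom.range_eq_map]

theorem smul_add_smul_add_mem_iff {T : Set V} (hT : T ⊆ S) (t : ℤ) (p : ℤ × ℤ) {x y : ℝ} :
    x • u + y • (w + t • u) + intComb u w p ∈ T ↔
      ∃ m n : ℤ, (x, y) = ((m : ℝ), (n : ℝ)) ∧ intComb u w (m + t * n + p.1, n + p.2) ∈ T := by
  constructor
  · intro hmem
    obtain ⟨q, hq⟩ := h.subset_range (hT hmem)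
    have hcoord : (q.1 : ℝ) • u + (q.2 : ℝ) • w = (x + t * y + p.1) • u + (y + p.2) • w := by
      simp only [Int.cast_smul_eq_zsmul, ← intComb_apply, hq]
      rw [intComb_apply]
      module
    obtain ⟨hx, hy⟩ := h.eq_and_eq_of_smul_add_smul_eq hcoord
    refine ⟨q.1 - t * (q.2 - p.2) - p.1, q.2 - p.2, Prod.ext ?_ ?_, ?_⟩
    · push_cast
      rw [hx, hy]
      ring
    · push_cast
      rw [hy]
      ring
    · rw [← hq] at hmem
      convert hmem using 2
      ext <;> ring
  · rintro ⟨m, n, hxy, hmem⟩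
    obtain ⟨rfl, rfl⟩ := Prod.ext_iff.1 hxy
    convert hmem using 1
    simp only [intComb_apply]
    module

end IsLatticeBasis

end LatticeBases

section Coordinates

variable {ι : Type*} [Fintype ι] [DecidableEq ι] {v : ι → ℝ}

theorem IsShortVec.dotProduct_self (hv : IsShortVec v) : v ⬝ᵥ v = 1 := by
  obtain ⟨i, σ, rfl | rfl, rfl⟩ := hv <;> simp

theorem IsMiddleVec.dotProduct_self (hv : IsMiddleVec v) : v ⬝ᵥ v = 2 := by
  obtain ⟨i, j, hij, σ, τ, rfl | rfl, rfl | rfl, rfl⟩ := hv <;> simp [hij, hij.symm] <;> norm_num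

theorem IsLongVec.dotProduct_self (hv : IsLongVec v) : v ⬝ᵥ v = 4 := by
  obtain ⟨i, σ, rfl | rfl, rfl⟩ := hv <;> simp <;> norm_num

theorem IsShortVec.sum_eq (hv : IsShortVec v) : ∃ k : ℤ, ∑ i, v i = 1 + 2 * k := by
  obtain ⟨i, σ, rfl | rfl, rfl⟩ := hv
  · exact ⟨0, by simp⟩
  · exact ⟨-1, by simp; norm_num⟩

theorem IsMiddleVec.sum_eq (hv : IsMiddleVec v) : ∃ k : ℤ, ∑ i, v i = 2 * k := by
  obtain ⟨i, j, -, σ, τ, rfl | rfl, rfl | rfl, rfl⟩ := hv <;>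
    simp only [Pi.add_apply, Finset.sum_add_distrib, Fintype.sum_pi_single']
  exacts [⟨1, by norm_num⟩, ⟨0, by norm_num⟩, ⟨0, by norm_num⟩, ⟨-1, by norm_num⟩]

theorem IsLongVec.sum_eq (hv : IsLongVec v) : ∃ k : ℤ, ∑ i, v i = 2 + 4 * k := by
  obtain ⟨i, σ, rfl | rfl, rfl⟩ := hv
  · exact ⟨0, by simp⟩
  · exact ⟨-1, by simp; norm_num⟩

theorem IsBCVec.isShortVec_and_isLongVec_two_smul {ι : Type*} [Finite ι] [DecidableEq ι]
    {v : ι → ℝ} (hv : IsBCVec v) (h2v : IsBCVec ((2 : ℝ) • v)) :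
    IsShortVec v ∧ IsLongVec ((2 : ℝ) • v) := by
  cases nonempty_fintype ι
  have hnorm : ((2 : ℝ) • v) ⬝ᵥ ((2 : ℝ) • v) = 4 * (v ⬝ᵥ v) := by
    rw [smul_dotProduct, dotProduct_smul, smul_eq_mul, smul_eq_mul]
    ring
  rcases hv with hv | hv | hv <;> rcases h2v with h2v | h2v | h2v <;>
    rw [hv.dotProduct_self, h2v.dotProduct_self] at hnorm <;> norm_num at hnorm
  exact ⟨hv, h2v⟩

end Coordinates

section Comap

variable {Λ Λ' : Type*} [AddCommGroup Λ] [AddCommGroup Λ'] {S M L : Set Λ}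

theorem IsTranslationTriple.comap (h : IsTranslationTriple S M L) (φ : Λ' →+ Λ)
    (hS : S ⊆ Set.range φ) : IsTranslationTriple (φ ⁻¹' S) (φ ⁻¹' M) (φ ⁻¹' L) where
  zero_mem_S := by simpa using h.zero_mem_S
  zero_mem_M := by simpa using h.zero_mem_M
  nonempty_L := by
    obtain ⟨x, hx⟩ := h.nonempty_L
    obtain ⟨p, rfl⟩ := hS (h.L_subset hx)
    exact ⟨p, hx⟩
  neg_S s hs := by simpa using h.neg_S _ hs
  S_add_S s hs s' hs' := by
    simpa only [Set.mem_preimage, map_add, map_zsmul] using h.S_add_S _ hs _ hs'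
  S_add_M s hs m hm := by simpa using h.S_add_M _ hs _ hm
  S_add_L s hs x hx := by simpa using h.S_add_L _ hs _ hx
  M_add_S m hm s hs := by
    simpa only [Set.mem_preimage, map_add, map_zsmul] using h.M_add_S _ hm _ hs
  M_add_L m hm x hx := by simpa using h.M_add_L _ hm _ hx
  L_add_S x hx s hs := by
    simpa only [Set.mem_preimage, map_add, map_zsmul] using h.L_add_S _ hx _ hs
  L_add_M x hx m hm := by
    simpa only [Set.mem_preimage, map_add, map_zsmul] using h.L_add_M _ hx _ hm
  L_add_L x hx y hy := by
    simpa only [Set.mem_preimage, map_add, map_zsmul] using h.L_add_L _ hx _ hy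

end Comap

section Reduced

variable {V : Type*} [AddCommGroup V] [Module ℝ V] {ι : Type*} [Fintype ι] [DecidableEq ι]
  {J : LinearMap.BilinForm ℝ V} {R : Set V} {e : ι → V} {S M L : Set V}

namespace IsBCFibration

theorem mem_ker_of_mem_closure [Nonempty ι] (h : IsBCFibration J R e S M L) {s : V}
    (hs : s ∈ AddSubgroup.closure S) : s ∈ LinearMap.ker J :=
  (AddSubgroup.closure_le (LinearMap.ker J).toAddSubgroup).2 h.S_subset_ker hs

theorem two_smul_notMem_L [Nonempty ι] (h : IsBCFibration J R e S M L) (hred : IsReduced R)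
    {r : V} (hr : r ∈ S) : (2 : ℝ) • r ∉ L := by
  let i : ι := Classical.arbitrary ι
  intro h2r
  have hker := h.S_subset_ker hr
  have hshort : comb e (Pi.single i 1) + r ∈ R :=
    (h.comb_add_mem_iff hker).2 (Or.inl ⟨⟨i, 1, Or.inl rfl, rfl⟩, hr⟩)
  have hlong : comb e (Pi.single i 2) + (2 : ℝ) • r ∈ R :=
    (h.comb_add_mem_iff (Submodule.smul_mem _ 2 hker)).2
      (Or.inr (Or.inr ⟨⟨i, 1, Or.inl rfl, by rw [mul_one]⟩, h2r⟩))
  refine (hred _ hshort).1 ?_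
  rwa [smul_add, comb_single, one_smul, ← comb_single]

theorem exists_mem_L_sub_two_smul_mem (h : IsBCFibration J R e S M L) {G : Submodule ℝ V}
    (hG : G ≤ LinearMap.ker J) {α β : V} (hα : α ∈ R) (hβ : β ∈ R)
    (hαβ : β - (2 : ℝ) • α ∈ G) : ∃ r ∈ L, ∃ s ∈ S, r - (2 : ℝ) • s ∈ G := by
  obtain ⟨v, hv, hαv⟩ := h.exists_coords α hα
  obtain ⟨v', hv', hβv⟩ := h.exists_coords β hβ
  obtain rfl : v' = (2 : ℝ) • v := funext fun i => by
    rw [← h.apply_eq_of_sub_comb_mem hβv i, h.symm, apply_eq_of_sub_mem_ker (hG hαβ), h.symm,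
      map_smul, h.apply_eq_of_sub_comb_mem hαv i, Pi.smul_apply]
  obtain ⟨hshort, hlong⟩ := hv.isShortVec_and_isLongVec_two_smul hv'
  refine ⟨β - comb e ((2 : ℝ) • v), ?_, α - comb e v, ?_, ?_⟩
  · exact h.long _ hlong ▸ ⟨hβv, by rwa [add_sub_cancel]⟩
  · exact h.short _ hshort ▸ ⟨hαv, by rwa [add_sub_cancel]⟩
  · rwa [map_smul, smul_sub, sub_sub_sub_cancel_right]

theorem isReducedTranslationTriple [Nonempty ι] (h : IsBCFibration J R e S M L)
    (hred : IsReduced R) {u w : V} (huw : IsLatticeBasis S u w)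
    {α β : V} (hα : α ∈ R) (hβ : β ∈ R)
    (hαβ : β - (2 : ℝ) • α ∈ Submodule.span ℝ {u}) :
    IsReducedTranslationTriple (intComb u w ⁻¹' S) (intComb u w ⁻¹' M) (intComb u w ⁻¹' L) where
  toIsTranslationTriple := h.toIsTranslationTriple.comap _ huw.subset_range
  closure_S := huw.closure_preimage
  reduced m n hmn h2mn := by
    refine h.two_smul_notMem_L hred hmn ?_
    have hdouble : intComb u w (2 * m, 2 * n) = (2 : ℝ) • intComb u w (m, n) := by
      simp only [intComb_apply]
      module
    rwa [← hdouble]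
  nonreduced := by
    have hG : Submodule.span ℝ {u} ≤ LinearMap.ker J :=
      (Submodule.span_singleton_le_iff_mem _ _).2
        (h.mem_ker_of_mem_closure huw.left_mem_closure)
    obtain ⟨r, hr, s, hs, hrs⟩ := h.exists_mem_L_sub_two_smul_mem hG hα hβ hαβ
    obtain ⟨⟨m, n⟩, rfl⟩ := huw.subset_range (h.L_subset hr)
    obtain ⟨⟨p, q⟩, rfl⟩ := huw.subset_range hs
    obtain ⟨t, ht⟩ := Submodule.mem_span_singleton.1 hrs
    have hcoord : (m : ℝ) • u + (n : ℝ) • w = (2 * p + t) • u + (2 * q : ℝ) • w := by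
      rw [add_smul, ht, intComb_apply, intComb_apply]
      module
    obtain rfl : n = 2 * q := mod_cast (huw.eq_and_eq_of_smul_add_smul_eq hcoord).2
    exact ⟨m, q, hr⟩

end IsBCFibration

end Reduced

section Frames

variable {V : Type*} [AddCommGroup V] [Module ℝ V]

theorem comb_add_const {ι : Type*} [Fintype ι] (e : ι → V) (s : V) (v : ι → ℝ) :
    comb (fun i => e i + s) v = comb e v + (∑ i, v i) • s := by
  simp only [comb, Fintype.linearCombination_apply, smul_add, Finset.sum_add_distrib,
    Finset.sum_smul]

theorem IsBCFibration.comb_add_const_mem_iff {ι : Type*} [Fintype ι] [DecidableEq ι] [Nonempty ι]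
    {J : LinearMap.BilinForm ℝ V} {R : Set V} {e : ι → V} {S M L : Set V}
    (h : IsBCFibration J R e S M L) {s r : V} (hs : s ∈ AddSubgroup.closure S)
    (hr : r ∈ LinearMap.ker J) (v : ι → ℝ) :
    comb (fun i => e i + s) v + r ∈ R ↔
      (IsShortVec v ∧ r + s ∈ S) ∨ (IsMiddleVec v ∧ r ∈ M) ∨
        (IsLongVec v ∧ r + (2 : ℤ) • s ∈ L) := by
  have hsker : s ∈ LinearMap.ker J := h.mem_ker_of_mem_closure hs
  rw [comb_add_const, add_assoc, h.comb_add_mem_iff (add_mem (Submodule.smul_mem _ _ hsker) hr)]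
  refine or_congr (and_congr_right fun hv => ?_)
    (or_congr (and_congr_right fun hv => ?_) (and_congr_right fun hv => ?_))
  · obtain ⟨k, hk⟩ := hv.sum_eq
    rw [← add_zsmul_mem_iff_of_mem_closure h.S_add_S h.neg_S (zsmul_mem hs k) (r + s), hk]
    apply iff_of_eq
    congr 1
    module
  · obtain ⟨k, hk⟩ := hv.sum_eq
    rw [← add_zsmul_mem_iff_of_mem_closure h.M_add_S h.neg_S (zsmul_mem hs k) r, hk]
    apply iff_of_eq
    congr 1
    module
  · obtain ⟨k, hk⟩ := hv.sum_eq
    rw [← add_zsmul_mem_iff_of_mem_closure h.L_add_S h.neg_S (zsmul_mem hs k) (r + (2 : ℤ) • s),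
      hk]
    apply iff_of_eq
    congr 1
    module

variable {l : ℕ}

/-- The linear map with `ε_i ↦ e i`, `a ↦ x` and `b ↦ y`. -/
def frameMap (e : Fin l → V) (x y : V) : Space l →ₗ[ℝ] V :=
  (comb e).coprod ((LinearMap.toSpanSingleton ℝ V x).coprod (LinearMap.toSpanSingleton ℝ V y))

theorem frameMap_apply (e : Fin l → V) (x y : V) (z : Space l) :
    frameMap e x y z = comb e z.1 + (z.2.1 • x + z.2.2 • y) := rfl

theorem frameMap_sub_comb_mem_ker {J : LinearMap.BilinForm ℝ V} (e : Fin l → V) {s x y : V}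
    (hs : s ∈ LinearMap.ker J) (hx : x ∈ LinearMap.ker J) (hy : y ∈ LinearMap.ker J)
    (z : Space l) : frameMap (fun i => e i + s) x y z - comb e z.1 ∈ LinearMap.ker J := by
  rw [frameMap_apply, comb_add_const, add_assoc, add_sub_cancel_left]
  exact add_mem (Submodule.smul_mem _ _ hs)
    (add_mem (Submodule.smul_mem _ _ hx) (Submodule.smul_mem _ _ hy))

theorem IsOrthonormalRootFamily.apply_frameMap_frameMap {J : LinearMap.BilinForm ℝ V} {R : Set V}
    {e : Fin l → V} (h : IsOrthonormalRootFamily J R e) {s x y : V} (hs : s ∈ LinearMap.ker J)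
    (hx : x ∈ LinearMap.ker J) (hy : y ∈ LinearMap.ker J) (z z' : Space l) :
    J (frameMap (fun i => e i + s) x y z) (frameMap (fun i => e i + s) x y z') = form l z z' := by
  rw [apply_eq_of_sub_mem_ker (frameMap_sub_comb_mem_ker e hs hx hy z), h.symm,
    apply_eq_of_sub_mem_ker (frameMap_sub_comb_mem_ker e hs hx hy z'), h.symm, h.comb_apply_comb]
  rfl

theorem IsOrthonormalRootFamily.frameMap_injective {J : LinearMap.BilinForm ℝ V} {R : Set V}
    {e : Fin l → V} (h : IsOrthonormalRootFamily J R e) {s x y : V} (hs : s ∈ LinearMap.ker J)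
    (hx : x ∈ LinearMap.ker J) (hy : y ∈ LinearMap.ker J)
    (hxy : ∀ p q : ℝ, p • x + q • y = 0 → p = 0 ∧ q = 0) :
    Function.Injective (frameMap (fun i => e i + s) x y) := by
  refine (injective_iff_map_eq_zero _).2 fun z hz => ?_
  have hv : z.1 = 0 := by
    have hform := h.apply_frameMap_frameMap hs hx hy z z
    rw [hz, map_zero] at hform
    exact dotProduct_self_eq_zero.1 hform.symm
  rw [frameMap_apply, hv, map_zero, zero_add] at hz
  exact Prod.ext hv (Prod.ext (hxy _ _ hz).1 (hxy _ _ hz).2)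

namespace IsBCFibration

variable [NeZero l] {J : LinearMap.BilinForm ℝ V} {R : Set V} {e : Fin l → V} {S M L : Set V}
  {u w : V} {S₀ M₀ L₀ : Set (ℤ × ℤ)}

theorem frameMap_mem_iff (h : IsBCFibration J R e S M L) (huw : IsLatticeBasis S u w)
    {c₁ c₂ t : ℤ}
    (hnf : ∀ m n, ((m + t * n + c₁, n + c₂) ∈ intComb u w ⁻¹' S ↔ (m, n) ∈ S₀) ∧
      ((m + t * n, n) ∈ intComb u w ⁻¹' M ↔ (m, n) ∈ M₀) ∧
      ((m + t * n + 2 * c₁, n + 2 * c₂) ∈ intComb u w ⁻¹' L ↔ (m, n) ∈ L₀)) (z : Space l) :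
    frameMap (fun i => e i + intComb u w (c₁, c₂)) u (w + t • u) z ∈ R ↔
      z ∈ bcSystem l S₀ M₀ L₀ := by
  obtain ⟨v, x, y⟩ := z
  have hr : x • u + y • (w + t • u) ∈ LinearMap.ker J := by
    have hu := h.mem_ker_of_mem_closure huw.left_mem_closure
    have hw := h.mem_ker_of_mem_closure huw.right_mem_closure
    exact add_mem (Submodule.smul_mem _ _ hu) (Submodule.smul_mem _ _ (add_mem hw (zsmul_mem hu t)))
  have hS := huw.smul_add_smul_add_mem_iff subset_rfl t (c₁, c₂) (x := x) (y := y)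
  have hM := huw.smul_add_smul_add_mem_iff h.M_subset t 0 (x := x) (y := y)
  have hL := huw.smul_add_smul_add_mem_iff h.L_subset t ((2 : ℤ) • (c₁, c₂)) (x := x) (y := y)
  simp only [map_zero, Prod.fst_zero, Prod.snd_zero, add_zero] at hM
  rw [frameMap_apply, h.comb_add_const_mem_iff (huw.intComb_mem_closure _) hr, ← map_zsmul, hS, hM,
    hL, mem_bcSystem_iff]
  simp only [Set.mem_preimage] at hnf
  simp only [Prod.smul_mk, smul_eq_mul, (hnf _ _).1, (hnf _ _).2.1, (hnf _ _).2.2,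
    ← exists_and_left, ← exists_or]
  refine exists_congr fun m => exists_congr fun n => ?_
  tauto

theorem exists_linearEquiv_preimage_eq_bcSystem (h : IsBCFibration J R e S M L)
    (huw : IsLatticeBasis S u w) (hdim : Module.finrank ℝ V = l + 2)
    (hnf : HasNormalForm (intComb u w ⁻¹' S) (intComb u w ⁻¹' M) (intComb u w ⁻¹' L) S₀ M₀ L₀) :
    ∃ ψ : Space l ≃ₗ[ℝ] V, ψ ⁻¹' R = bcSystem l S₀ M₀ L₀ ∧
      (∀ z z', J (ψ z) (ψ z') = form l z z') ∧ ψ (a l) = u := by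
  obtain ⟨c₁, c₂, t, hnf⟩ := hnf
  have : FiniteDimensional ℝ V := Module.finite_of_finrank_pos (by omega)
  have hs := h.mem_ker_of_mem_closure (huw.intComb_mem_closure (c₁, c₂))
  have hu := h.mem_ker_of_mem_closure huw.left_mem_closure
  have hw := add_mem (h.mem_ker_of_mem_closure huw.right_mem_closure) (zsmul_mem hu t)
  have hli (p q : ℝ) (hpq : p • u + q • (w + t • u) = 0) : p = 0 ∧ q = 0 := by
    obtain ⟨hp, rfl⟩ := huw.eq_and_eq_of_smul_add_smul_eq (x := p + q * t) (y := q) (x' := 0)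
      (y' := 0) (by rw [zero_smul, zero_smul, add_zero, ← hpq]; module)
    exact ⟨by simpa using hp, rfl⟩
  have hinj := h.frameMap_injective hs hu hw hli
  refine ⟨.ofInjectiveOfFinrankEq _ hinj (by simp [hdim]), Set.ext (h.frameMap_mem_iff huw hnf),
    h.apply_frameMap_frameMap hs hu hw, ?_⟩
  change frameMap _ u _ (a l) = u
  simp [frameMap_apply, a]

end IsBCFibration

end Frames

theorem MarkedIsoTo.of_symm {F : Type*} [NormedAddCommGroup F] [NormedSpace ℝ F]
    {I : LinearMap.BilinForm ℝ F} {R : Set F} {l : ℕ} {T : Set (Space l)} {c : ℝ} (hc : 0 < c)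
    (ψ : Space l ≃ₗ[ℝ] F) (hψR : ψ ⁻¹' R = T)
    (hψ : ∀ z z', c * I (ψ z) (ψ z') = form l z z') :
    MarkedIsoTo I R (Submodule.span ℝ {ψ (a l)}) l T := by
  refine ⟨ψ.symm, ⟨?_, c, hc, fun x y => ?_⟩, ?_⟩
  · rw [← hψR]
    exact ψ.symm.toEquiv.image_eq_preimage_symm R
  · simp [← hψ]
  · simp [Submodule.map_span, markingA]

theorem isReduced_quotientSystem_iff {F : Type*} [NormedAddCommGroup F] [NormedSpace ℝ F]
    {R : Set F} {G : Submodule ℝ F} :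
    IsReduced (quotientSystem R G) ↔ ∀ α ∈ R, ∀ β ∈ R, β - (2 : ℝ) • α ∉ G := by
  have hmem (α β : F) : (2 : ℝ) • G.mkQ α = G.mkQ β ↔ β - (2 : ℝ) • α ∈ G := by
    rw [eq_comm, ← map_smul]
    exact Submodule.Quotient.eq G
  constructor
  · exact fun h α hα β hβ hαβ =>
      (h _ (Set.mem_image_of_mem _ hα)).1 ⟨β, hβ, ((hmem α β).2 hαβ).symm⟩
  · rintro h _ ⟨α, hα, rfl⟩
    constructor
    · rintro ⟨β, hβ, hαβ⟩
      exact h α hα β hβ ((hmem α β).1 hαβ.symm)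
    · rintro ⟨β, hβ, hαβ⟩
      refine h β hβ α hα ((hmem β α).1 ?_)
      rw [hαβ, smul_smul]
      norm_num

theorem reducedClassical_BBvee_eq_CveeC {l : ℕ} (hl : l < 2) :
    reducedClassical l .BBvee = reducedClassical l .CveeC := by
  rw [reducedClassical_eq_bcSystem, reducedClassical_eq_bcSystem]
  exact bcSystem_congr_middle_of_lt_two hl _ _ _ _

section Elliptic

variable {F : Type*} [NormedAddCommGroup F] [NormedSpace ℝ F] {I : LinearMap.BilinForm ℝ F}
  {l : ℕ} {R : Set F} {G : Submodule ℝ F}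

theorem IsMarking.exists_ne_zero (hG : IsMarking I R G) : ∃ g ∈ G, g ≠ 0 ∧ g ∈ rootLattice R := by
  have hne : Submodule.span ℝ ((G : Set F) ∩ (rootLattice R : Set F)) ≠ ⊥ := by
    rw [hG.full]
    rintro rfl
    simpa using hG.finrank_eq
  obtain ⟨g, ⟨hgG, hgR⟩, hg0⟩ := by simpa only [ne_eq, Submodule.span_eq_bot, not_forall] using hne
  exact ⟨g, hgG, hg0, hgR⟩

theorem isMarking_span_singleton {g : F} (hg : g ∈ rad I) (hg0 : g ≠ 0) (hgR : g ∈ rootLattice R) :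
    IsMarking I R (Submodule.span ℝ {g}) where
  le_rad := by simpa using hg
  finrank_eq := finrank_span_singleton hg0
  full := by
    refine le_antisymm (Submodule.span_le.2 Set.inter_subset_left) ?_
    rw [Submodule.span_singleton_le_iff_mem]
    exact Submodule.subset_span ⟨Submodule.mem_span_singleton_self g, hgR⟩

namespace IsElliptic

theorem finiteDimensional (hR : IsElliptic I l R) : FiniteDimensional ℝ F :=
  Module.finite_of_finrank_pos (by rw [hR.finrank_space]; omega)

theorem span_eq_top (hR : IsElliptic I l R) : Submodule.span ℝ R = ⊤ := by
  rw [← hR.rootSystem.full, rootLattice, Submodule.span_span_of_tower]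

theorem isSemidefRootSystem (hR : IsElliptic I l R) : IsSemidefRootSystem I R where
  symm x y := by simpa using hR.posSemidef.1.1 x y
  nonneg x := hR.posSemidef.2.1 x
  pos α hα := (hR.posSemidef.2.1 α).lt_of_ne (hR.rootSystem.nonisotropic α hα).symm
  integral α hα β hβ := by
    have hα0 := hR.rootSystem.nonisotropic α hα
    obtain ⟨n, hn⟩ := hR.rootSystem.integral α hα β hβ
    refine ⟨n, ?_⟩
    rw [← hn, coroot, map_smul, LinearMap.smul_apply, smul_eq_mul]
    field_simp
  reflect_mem α hα β hβ t ht := by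
    have hα0 := hR.rootSystem.nonisotropic α hα
    have hsymm : I β α = I α β := by simpa using hR.posSemidef.1.1 β α
    have hreflect : reflect I α β = β - t • α := by
      rw [reflect, coroot, map_smul, smul_eq_mul, hsymm, div_mul_eq_mul_div, ht,
        mul_div_cancel_right₀ t hα0]
    rw [← hreflect, ← hR.rootSystem.reflect_image α hα]
    exact Set.mem_image_of_mem _ hβ
  irreducible := hR.rootSystem.irreducible

theorem exists_isBCFibration (hR : IsElliptic I l R) {α β : F} (hα : α ∈ R) (hβ : β ∈ R)
    (hαβ : β - (2 : ℝ) • α ∈ rad I) :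
    NeZero l ∧ ∃ c : ℝ, 0 < c ∧ LinearMap.ker (c • I) = rad I ∧
      ∃ (e : Fin l → F) (S M L : Set F), IsBCFibration (c • I) R e S M L := by
  have := hR.finiteDimensional
  have hαpos := hR.isSemidefRootSystem.pos α hα
  have hc : 0 < (I α α)⁻¹ := inv_pos.2 hαpos
  have hker : LinearMap.ker ((I α α)⁻¹ • I) = rad I := LinearMap.ker_smul _ _ hc.ne'
  obtain ⟨n, e, he⟩ := exists_isBCFrame (hR.isSemidefRootSystem.smul hc)
    ⟨hα, by simp [hαpos.ne'], β, hβ, hker ▸ hαβ⟩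
  obtain ⟨S, M, L, h⟩ := he.exists_isBCFibration
  obtain rfl : n + 1 = l := by
    have hcard := h.card_add_finrank_ker hR.span_eq_top
    rw [hker, hR.finrank_rad, hR.finrank_space, Fintype.card_fin] at hcard
    exact Nat.add_right_cancel hcard
  exact ⟨inferInstance, _, hc, hker, e, S, M, L, h⟩

theorem exists_isLatticeBasis [NeZero l] (hR : IsElliptic I l R) (hG : IsMarking I R G)
    {c : ℝ} (hker : LinearMap.ker (c • I) = rad I) {e : Fin l → F} {S M L : Set F}
    (h : IsBCFibration (c • I) R e S M L) :
    ∃ u w, IsLatticeBasis S u w ∧ Submodule.span ℝ {u} = G := by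
  have := hR.finiteDimensional
  obtain ⟨g, hgG, hg0, hgR⟩ := hG.exists_ne_zero
  have hdisc : DiscreteTopology (Submodule.span ℤ S) := by
    have := hR.rootSystem.lattice
    exact DiscreteTopology.of_subset (s := (rootLattice R : Set F)) this
      (Submodule.span_le.2 h.S_subset_span)
  have hrank : Module.finrank ℝ (Submodule.span ℝ S) = 2 := by
    rw [h.span_S hR.span_eq_top, hker, hR.finrank_rad]
  have hgS := h.mem_span_of_mem_ker ℤ hgR (hker ▸ hG.le_rad hgG)
  obtain ⟨u, w, huw, hspan⟩ := EllipticRoot.exists_isLatticeBasis hdisc hrank hg0 hgS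
  refine ⟨u, w, huw, hspan.trans (Submodule.eq_of_le_of_finrank_eq ?_ ?_)⟩
  · rwa [Submodule.span_singleton_le_iff_mem]
  · rw [finrank_span_singleton hg0, hG.finrank_eq]

theorem markedIsoTo_reducedClassical_or_star (hR : IsElliptic I l R) (hred : IsReduced R)
    (hG : IsMarking I R G) (hnr : ¬ IsReduced (quotientSystem R G)) :
    (∃ X, MarkedIsoTo I R G l (reducedClassical l X)) ∨ MarkedIsoTo I R G l (BC11star l) ∨
      MarkedIsoTo I R G l (BC44star l) := by
  obtain ⟨α, hα, β, hβ, hαβ⟩ : ∃ α ∈ R, ∃ β ∈ R, β - (2 : ℝ) • α ∈ G := by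
    simpa [isReduced_quotientSystem_iff] using hnr
  obtain ⟨_, c, hc, hker, e, S, M, L, h⟩ := hR.exists_isBCFibration hα hβ (hG.le_rad hαβ)
  obtain ⟨u, w, huw, rfl⟩ := hR.exists_isLatticeBasis hG hker h
  have hiso {S₀ M₀ L₀ : Set (ℤ × ℤ)}
      (hnf : HasNormalForm (intComb u w ⁻¹' S) (intComb u w ⁻¹' M) (intComb u w ⁻¹' L) S₀ M₀ L₀) :
      MarkedIsoTo I R (Submodule.span ℝ {u}) l (bcSystem l S₀ M₀ L₀) := by
    obtain ⟨ψ, hψR, hψ, rfl⟩ :=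
      h.exists_linearEquiv_preimage_eq_bcSystem huw hR.finrank_space hnf
    exact .of_symm hc ψ hψR hψ
  have htriple := h.isReducedTranslationTriple hred huw hα hβ hαβ
  simp only [reducedClassical_eq_bcSystem, BC11star_eq_bcSystem, BC44star_eq_bcSystem]
  exact htriple.hasNormalForm.imp (fun ⟨X, hX⟩ => ⟨X, hiso hX⟩) (Or.imp hiso hiso)

theorem markedIsoTo (hR : IsElliptic I l R) (hred : IsReduced R) (hG : IsMarking I R G)
    (hnr : ¬ IsReduced (quotientSystem R G)) :
    MarkedIsoTo I R G l (BC12 l) ∨ MarkedIsoTo I R G l (BC11star l) ∨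
      MarkedIsoTo I R G l (BC42 l) ∨ MarkedIsoTo I R G l (BC44star l) ∨
      MarkedIsoTo I R G l (BC22σ2 l) ∨ (2 ≤ l ∧ MarkedIsoTo I R G l (BC22σ1 l)) := by
  obtain ⟨X, h⟩ | h | h := hR.markedIsoTo_reducedClassical_or_star hred hG hnr
  · cases X with
    | BCC => exact .inl h
    | CveeBC => exact .inr (.inr (.inl h))
    | CveeC => exact .inr (.inr (.inr (.inr (.inl h))))
    | BBvee =>
      obtain hl | hl := le_or_gt 2 l
      · exact .inr (.inr (.inr (.inr (.inr ⟨hl, h⟩))))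
      · rw [reducedClassical_BBvee_eq_CveeC hl] at h
        exact .inr (.inr (.inr (.inr (.inl h))))
  · exact .inr (.inl h)
  · exact .inr (.inr (.inr (.inl h)))

end IsElliptic

end Elliptic

theorem exists_int_mulVec_eq_zero {n : Type*} [Fintype n] {K : Type*}
    [CommRing K] [IsDomain K] [CharZero K] (N : Matrix n n ℤ) {x : n → K} (hx : x ≠ 0)
    (hNx : N.map (Int.cast : ℤ → K) *ᵥ x = 0) : ∃ y : n → ℤ, y ≠ 0 ∧ N *ᵥ y = 0 := by
  classical
  rw [Matrix.exists_mulVec_eq_zero_iff]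
  have hdet : (N.map (Int.cast : ℤ → K)).det = 0 :=
    Matrix.exists_mulVec_eq_zero_iff.1 ⟨x, hx, hNx⟩
  exact_mod_cast (Int.cast_det N).trans hdet

section Elliptic

variable {F : Type*} [NormedAddCommGroup F] [NormedSpace ℝ F] {I : LinearMap.BilinForm ℝ F}
  {l : ℕ} {R : Set F}

/-- The integral matrix of the pairings `I(β_i^∨, β_j)`, for a basis of roots `β_i`, is singular. -/
theorem IsElliptic.exists_rootLattice_mem_rad (hR : IsElliptic I l R) :
    ∃ g ∈ rad I, g ≠ 0 ∧ g ∈ rootLattice R := by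
  have := hR.finiteDimensional
  obtain ⟨ι, B, hBR⟩ : ∃ (ι : Set F) (B : Module.Basis ι ℝ F), ∀ i, B i ∈ R :=
    ⟨_, .ofSpan hR.span_eq_top.ge, fun i => Module.Basis.ofSpan_subset _ ⟨i, rfl⟩⟩
  have := Module.Finite.finite_basis B
  have := Fintype.ofFinite ι
  choose N hN using fun i j => hR.rootSystem.integral _ (hBR i) _ (hBR j)
  have hpair (i : ι) (x : ι → ℝ) :
      I (coroot I (B i)) (∑ j, x j • B j) = ((Matrix.of N).map (Int.cast : ℤ → ℝ) *ᵥ x) i := by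
    simp [hN, Matrix.mulVec, dotProduct, mul_comm]
  obtain ⟨z, hz, hz0⟩ : ∃ z ∈ rad I, z ≠ 0 :=
    Submodule.exists_mem_ne_zero_of_ne_bot fun hbot => by
      have hrank := hR.finrank_rad
      rw [hbot, finrank_bot] at hrank
      norm_num at hrank
  obtain ⟨y, hy0, hNy⟩ : ∃ y : ι → ℤ, y ≠ 0 ∧ Matrix.of N *ᵥ y = 0 := by
    refine exists_int_mulVec_eq_zero _ (x := B.equivFun z) (by simpa using hz0) ?_
    ext i
    rw [← hpair, B.sum_equivFun, hR.isSemidefRootSystem.apply_eq_zero_of_mem_ker_right hz]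
    rfl
  refine ⟨∑ j, (y j : ℝ) • B j, ?_, fun h0 => hy0 ?_, ?_⟩
  · refine LinearMap.mem_ker.2 (B.ext fun i => ?_)
    have hcoroot : I (coroot I (B i)) (∑ j, (y j : ℝ) • B j) = 0 := by
      rw [hpair]
      have := congrArg (Int.cast : ℤ → ℝ) (congrFun hNy i)
      simpa [Matrix.mulVec, dotProduct] using this
    rw [coroot, map_smul, LinearMap.smul_apply, smul_eq_mul] at hcoroot
    rw [hR.isSemidefRootSystem.symm, LinearMap.zero_apply]
    exact (mul_eq_zero.1 hcoroot).resolve_left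
      (div_ne_zero two_ne_zero (hR.rootSystem.nonisotropic _ (hBR i)))
  · ext j
    exact_mod_cast Fintype.linearIndependent_iff.1 B.linearIndependent _ h0 j
  · refine Submodule.sum_mem _ fun j _ => ?_
    rw [Int.cast_smul_eq_zsmul]
    exact Submodule.smul_mem _ _ (Submodule.subset_span (hBR j))

end Elliptic

section Models

variable {l : ℕ}

theorem neZero_of_mem_reducedClassical {X : AffineType} {x : Space l}
    (hx : x ∈ reducedClassical l X) : NeZero l := by
  rw [reducedClassical_eq_bcSystem, mem_bcSystem_iff] at hx
  obtain ⟨m, n, -, ⟨⟨i, -⟩, -⟩ | ⟨⟨i, -⟩, -⟩ | ⟨⟨i, -⟩, -⟩⟩ := hx <;> exact ⟨i.pos.ne'⟩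

theorem b_mem_ker_form : b l ∈ LinearMap.ker (form l) := by
  refine LinearMap.mem_ker.2 (LinearMap.ext fun x => ?_)
  simp [b, form_apply]

theorem b_mem_span_reducedClassical [NeZero l] (X : AffineType) :
    b l ∈ Submodule.span ℤ (reducedClassical l X) := by
  have hε (n : ℤ) : ε l 0 + (n : ℝ) • b l ∈ reducedClassical l X := by
    rw [reducedClassical_eq_bcSystem, mem_bcSystem_iff]
    exact ⟨0, n, by simp [ε, b], .inl ⟨⟨0, 1, by simp [ε, b]⟩, trivial⟩⟩
  have hb : b l = ε l 0 + ((1 : ℤ) : ℝ) • b l - (ε l 0 + ((0 : ℤ) : ℝ) • b l) := by simp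
  rw [hb]
  exact sub_mem (Submodule.subset_span (hε 1)) (Submodule.subset_span (hε 0))

theorem sub_two_smul_notMem_span_b {X : AffineType} {x y : Space l}
    (hx : x ∈ reducedClassical l X) (hy : y ∈ reducedClassical l X) :
    y - (2 : ℝ) • x ∉ Submodule.span ℝ {b l} := by
  intro hxy
  obtain ⟨t, ht⟩ := Submodule.mem_span_singleton.1 hxy
  have hyx : y = (2 : ℝ) • x + t • b l := by
    rw [ht]
    module
  rw [reducedClassical_eq_bcSystem, mem_bcSystem_iff] at hx hy
  obtain ⟨m, n, hmn, hx⟩ := hx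
  obtain ⟨p, q, hpq, hy⟩ := hy
  have hlong : IsLongVec y.1 := by
    have hv : y.1 = (2 : ℝ) • x.1 := by simp [hyx, b]
    rw [hv]
    exact (IsBCVec.isShortVec_and_isLongVec_two_smul (hx.imp And.left (Or.imp And.left And.left))
      (hv ▸ hy.imp And.left (Or.imp And.left And.left))).2
  have hodd : Odd p := by
    rcases hy with ⟨hshort, -⟩ | ⟨hmiddle, -⟩ | ⟨-, hodd, -⟩
    · have := hshort.dotProduct_self.symm.trans hlong.dotProduct_self
      norm_num at this
    · have := hmiddle.dotProduct_self.symm.trans hlong.dotProduct_self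
      norm_num at this
    · exact hodd
  have heven : (p : ℝ) = 2 * m := by
    simpa [hpq, hmn, b] using congrArg (fun z : Space l => z.2.1) hyx
  exact Int.not_even_iff_odd.2 hodd ⟨m, by rw [← two_mul]; exact_mod_cast heven⟩

end Models

section Isomorphism

variable {F F' : Type*} [NormedAddCommGroup F] [NormedSpace ℝ F] [NormedAddCommGroup F']
  [NormedSpace ℝ F'] {I : LinearMap.BilinForm ℝ F} {R : Set F} {I' : LinearMap.BilinForm ℝ F'}
  {R' : Set F'} {φ : F ≃ₗ[ℝ] F'}

namespace IsRootSystemIso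

theorem symm_mem_rad (h : IsRootSystemIso I R I' R' φ) {y : F'} (hy : y ∈ rad I') :
    φ.symm y ∈ rad I := by
  obtain ⟨-, c, hc, hI⟩ := h
  refine LinearMap.mem_ker.2 (LinearMap.ext fun x => ?_)
  have hcI := hI (φ.symm y) x
  rw [φ.apply_symm_apply, LinearMap.mem_ker.1 hy, LinearMap.zero_apply] at hcI
  exact (mul_eq_zero.1 hcI.symm).resolve_left hc.ne'

theorem symm_mem_rootLattice (h : IsRootSystemIso I R I' R' φ) {y : F'} (hy : y ∈ rootLattice R') :
    φ.symm y ∈ rootLattice R := by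
  rw [rootLattice, ← h.1] at hy
  change y ∈ Submodule.span ℤ ((φ.toLinearMap.restrictScalars ℤ) '' R) at hy
  rw [Submodule.span_image] at hy
  obtain ⟨x, hx, rfl⟩ := hy
  exact (φ.symm_apply_apply x).symm ▸ hx

theorem map_mem (h : IsRootSystemIso I R I' R' φ) {x : F} (hx : x ∈ R) : φ x ∈ R' :=
  h.1 ▸ Set.mem_image_of_mem φ hx

end IsRootSystemIso

end Isomorphism

section Elliptic

variable {F : Type*} [NormedAddCommGroup F] [NormedSpace ℝ F] {I : LinearMap.BilinForm ℝ F}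
  {l : ℕ} {R : Set F} {G : Submodule ℝ F}

theorem exists_isMarking_isReduced_quotientSystem (hR : R.Nonempty) {X : AffineType}
    (hiso : IsoTo I R l (reducedClassical l X)) :
    ∃ G : Submodule ℝ F, IsMarking I R G ∧ IsReduced (quotientSystem R G) := by
  obtain ⟨φ, hφ⟩ := hiso
  have : NeZero l := neZero_of_mem_reducedClassical (hφ.map_mem hR.some_mem)
  refine ⟨Submodule.span ℝ {φ.symm (b l)}, isMarking_span_singleton (hφ.symm_mem_rad b_mem_ker_form)
    (by simp [b]) (hφ.symm_mem_rootLattice (b_mem_span_reducedClassical X)),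
    isReduced_quotientSystem_iff.2 fun α hα β hβ hαβ =>
      sub_two_smul_notMem_span_b (hφ.map_mem hα) (hφ.map_mem hβ) ?_⟩
  rw [← map_smul, ← map_sub]
  simpa [Submodule.map_span] using Submodule.mem_map_of_mem (f := φ.toLinearMap) hαβ

theorem MarkedIsoTo.isoTo {T : Set (Space l)} (h : MarkedIsoTo I R G l T) : IsoTo I R l T :=
  h.imp fun _ => And.left

end Elliptic

end EllipticRoot

end

open EllipticRoot in
theorem mainTheorem2 {F : Type*} [NormedAddCommGroup F] [NormedSpace ℝ F]
    (I : LinearMap.BilinForm ℝ F) (l : ℕ) (R : Set F)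
    (hR : IsElliptic I l R) (hred : IsReduced R) :
    (∀ G : Submodule ℝ F, IsMarking I R G → ¬ IsReduced (quotientSystem R G) →
      MarkedIsoTo I R G l (BC12 l) ∨ MarkedIsoTo I R G l (BC11star l) ∨
      MarkedIsoTo I R G l (BC42 l) ∨ MarkedIsoTo I R G l (BC44star l) ∨
      MarkedIsoTo I R G l (BC22σ2 l) ∨ (2 ≤ l ∧ MarkedIsoTo I R G l (BC22σ1 l))) ∧
    ((∃ G : Submodule ℝ F, IsMarking I R G ∧ IsReduced (quotientSystem R G)) ∨
      IsoTo I R l (BC11star l) ∨ IsoTo I R l (BC44star l)) := by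
  refine ⟨fun G hG hnr => hR.markedIsoTo hred hG hnr, ?_⟩
  obtain ⟨g, hg, hg0, hgR⟩ := hR.exists_rootLattice_mem_rad
  have hG := isMarking_span_singleton hg hg0 hgR
  by_cases hq : IsReduced (quotientSystem R (Submodule.span ℝ {g}))
  · exact .inl ⟨_, hG, hq⟩
  obtain ⟨X, h⟩ | h | h := hR.markedIsoTo_reducedClassical_or_star hred hG hq
  · exact .inl (exists_isMarking_isReduced_quotientSystem hR.rootSystem.nonempty h.isoTo)
  · exact .inr (.inl h.isoTo)
  · exact .inr (.inr h.isoTo)
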